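/- Let $n\ge 2$, $k\ge 3$, $V=\mathbb R^n$, $V_0=V\setminus\{0\}$, $G=\mathrm{GL}(n,\mathbb R)$, and call homogeneous polynomials $h,h'$ of degree $k$ on $V$ *$G$-equivalent* if $h'=h\circ A$ for some $A\in G$. **Jets and invariants.** Let $\mathcal E_3$ be the set of 3-jets $(x,u,u_i,u_{ij},u_{ijl})$ of functions at points $x\in V_0$ (with $u_{ij}$, $u_{ijl}$ symmetric) satisfying $\sum_i x_iu_i=ku$, $\sum_i x_iu_{ij}=(k-1)u_j$, $\sum_i x_iu_{ijl}=(k-2)u_{jl}$. The group $G$ acts on 3-jets by sending the jet of $f$ at $v$ to the jet of $f\circ A^{-1}$ at $Av$. A *rational invariant of order $\le 3$* is a $G$-invariant rational function $P/Q$ on $\mathcal E_3$, where $P,Q$ are polynomials in the jet coordinates and $Q\not\equiv0$ on $\mathcal E_3$. Evaluating it on $j_3h$ gives a rational function $(P/Q)(h)$ on $V$, provided $Q(j_3h)\not\equiv0$. The function $\Theta_0=u$ is an invariant, with $\Theta_0(h)=h$. **Frame.** At a 3-jet let $\Theta_1=\sum u_i\,dx_i$, $\Theta_2=\frac12\sum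 u_{ij}\,dx_idx_j$, $\Theta_3=\frac16\sum u_{ijl}\,dx_idx_jdx_l$, regarded as symmetric multilinear forms, and let $\Theta_2^0,\Theta_3^0$ be the restrictions of $\Theta_2,\Theta_3$ to $\ker\Theta_1$. When $\Theta_2^0$ is nondegenerate, let $\lambda$ be the linear form on $\ker\Theta_1$ obtained by contracting $\Theta_3^0$ with the inverse tensor of $\Theta_2^0$. Let $\widehat\lambda\in\ker\Theta_1$ be given by $\Theta_2^0(\widehat\lambda,\cdot)=\lambda$, and let $\Phi$ be the operator on $\ker\Theta_1$ with $\Theta_2^0(\Phi X,Y)=\Theta_3^0(\widehat\lambda,X,Y)$. Put $e_1=\widehat\lambda$, $e_{i+1}=\Phi e_i$ for $1\le i\le n-2$, and $e_n=\delta=\sum x_i\partial_i$. The 3-jet is *regular* if $u\ne0$, $\Theta_2$ is nondegenerate and $e_1,\dots,e_{n-1}$ are linearly independent. **Regular forms.** A form $h$ of degree $k$ is *regular* if there are a point $v\in V_0$ at which $j_3h$ is regular and rational invariants $J_1,\dots,J_n=\Theta_0$ of order $\le3$, written as fractions whose denominators do not vanish at the 3-jet of $h$ at $v$, such that $dJ_1(h)\wedge\dots\wedge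 dJ_n(h)\ne0$ at $v$. For a regular $h$ the $e_a$ evaluated on $j_3h$ form a frame of rational vector fields on $V$. **The set $\Pi_h$.** Fractions representing rational invariants $J_1,\dots,J_n=\Theta_0$ of order $\le 3$ are *in general position along $h$* if their denominators do not vanish identically on $j_3h$ and $dJ_1(h)\wedge\dots\wedge dJ_n(h)\not\equiv0$. For such $J$ put $J(h)=(J_b(h))_b$ and $U(h)=(e_a(J_b(h)))_{a,b}$, and let $\Gamma(h)=(\Gamma_{ab}^c)_{a,b,c}$ be defined by $\nabla_{e_a}e_b=\sum_c\Gamma_{ab}^ce_c$, where $\nabla$ is the standard flat connection of $V$. Let $\Pi_h\subset\mathbb R^n\times\mathbb R^{n^2}\times\mathbb R^{n^3}$ be the image of the rational map $v\mapsto(J(h)(v),U(h)(v),\Gamma(h)(v))$, that is, the set of its values at all points $v\in V$ at which every component is defined (can be written as a fraction with denominator nonzero at $v$). **Theorem.** Let $h,h'$ be regular forms of degree $k\ge3$ in $n\ge2$ variables. 1. For every system of invariants $J_1,\dots,J_n=\Theta_0$ of order $\le 3$ in general position along $h$ and along $h'$, the forms $h$ and $h'$ are $G$-equivalent if and only if $\Pi_h=\Pi_{h'}$.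 2. The forms $h$ and $h'$ are $G$-equivalent if and only if $\Pi_h=\Pi_{h'}$ for some such system $J$. -/

import Mathlib

open scoped BigOperators

noncomputable section

namespace FormJet

/-- The coordinates on the space of 3-jets of functions on an `n`-dimensional coordinate space:
base coordinates, value, and first, second and third partial derivatives. -/
inductive Coord (n : ℕ) : Type
  | x (i : Fin n)
  | u
  | u1 (i : Fin n)
  | u2 (i j : Fin n)
  | u3 (i j l : Fin n)

/-- A 3-jet with entries in `F`: base point, value, and partial derivatives of orders 1, 2, 3. -/
structure Jet3 (n : ℕ) (F : Type) where
  x : Fin n → F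
  u : F
  u1 : Fin n → F
  u2 : Fin n → Fin n → F
  u3 : Fin n → Fin n → Fin n → F

namespace Jet3

/-- The value of each jet coordinate on a jet. -/
def coord {n : ℕ} {F : Type} (a : Jet3 n F) : Coord n → F
  | .x i => a.x i
  | .u => a.u
  | .u1 i => a.u1 i
  | .u2 i j => a.u2 i j
  | .u3 i j l => a.u3 i j l

/-- The prolonged action of `A ∈ GL(n, ℝ)` on 3-jets: the 3-jet of `f` at `v` is sent to the 3-jet
of `f ∘ A⁻¹` at `A v`. -/
def act {n : ℕ} (A : GL (Fin n) ℝ) (a : Jet3 n ℝ) : Jet3 n ℝ :=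
  let B : Matrix (Fin n) (Fin n) ℝ := (A⁻¹ : GL (Fin n) ℝ).val
  { x := fun i => ∑ j, A.val i j * a.x j
    u := a.u
    u1 := fun i => ∑ p, a.u1 p * B p i
    u2 := fun i j => ∑ p, ∑ q, a.u2 p q * B p i * B q j
    u3 := fun i j l => ∑ p, ∑ q, ∑ r, a.u3 p q r * B p i * B q j * B r l }

section Frame

variable {n : ℕ} {F : Type} [Field F] (a : Jet3 n F)

/-- The kernel of `Θ₁ = ∑ uᵢ dxᵢ`. -/
def kerTheta1 : Submodule F (Fin n → F) :=
  LinearMap.ker (∑ i, a.u1 i • (LinearMap.proj i : (Fin n → F) →ₗ[F] F))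

/-- The coordinate 1-form `dxᵢ` restricted to `ker Θ₁`. -/
def dxKer (i : Fin n) : a.kerTheta1 →ₗ[F] F :=
  LinearMap.proj i ∘ₗ a.kerTheta1.subtype

/-- `Θ₂⁰`: the form `Θ₂ = (1/2) ∑ uᵢⱼ dxᵢ dxⱼ` restricted to `ker Θ₁`. -/
def theta20 : LinearMap.BilinForm F a.kerTheta1 :=
  ∑ i, ∑ j, ((1 / 2 : F) * a.u2 i j) • (a.dxKer i).smulRight (a.dxKer j)

/-- `Θ₃⁰`: the form `Θ₃ = (1/6) ∑ uᵢⱼₗ dxᵢ dxⱼ dxₗ` restricted to `ker Θ₁`. -/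
def theta30 : a.kerTheta1 →ₗ[F] LinearMap.BilinForm F a.kerTheta1 :=
  ∑ i, ∑ j, ∑ l, ((1 / 6 : F) * a.u3 i j l) •
    (a.dxKer i).smulRight ((a.dxKer j).smulRight (a.dxKer l))

open Classical in
/-- The inverse tensor of `Θ₂⁰`, as the map sending a 1-form `ξ` on `ker Θ₁` to the vector `X` with
`Θ₂⁰(X, ·) = ξ` (by convention `0` when `Θ₂⁰` is degenerate). -/
def sharp : Module.Dual F a.kerTheta1 →ₗ[F] a.kerTheta1 :=
  if h : a.theta20.Nondegenerate then (a.theta20.toDual h).symm.toLinearMap else 0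

/-- For `Z ∈ ker Θ₁`, the operator `X ↦ Φ_Z X` with `Θ₂⁰(Φ_Z X, Y) = Θ₃⁰(Z, X, Y)`. -/
def raise (Z : a.kerTheta1) : a.kerTheta1 →ₗ[F] a.kerTheta1 :=
  a.sharp ∘ₗ a.theta30 Z

/-- The 1-form `λ` on `ker Θ₁`: the contraction of `Θ₃⁰` with the inverse tensor of `Θ₂⁰`,
`λ(Z) = tr Φ_Z`. -/
def lam : Module.Dual F a.kerTheta1 where
  toFun Z := LinearMap.trace F a.kerTheta1 (a.raise Z)
  map_add' Z Z' := by simp [raise, LinearMap.comp_add]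
  map_smul' c Z := by simp [raise, LinearMap.comp_smul]

/-- The vector of `ker Θ₁` dual to `λ` with respect to `Θ₂⁰`. -/
def lamHat : a.kerTheta1 := a.sharp a.lam

/-- The operator `Φ` on `ker Θ₁` with `Θ₂⁰(Φ X, Y) = Θ₃⁰(λ̂, X, Y)`. -/
def Phi : a.kerTheta1 →ₗ[F] a.kerTheta1 := a.raise a.lamHat

/-- The vectors `λ̂, Φ λ̂, Φ² λ̂, …` of `ker Θ₁`. -/
def krylov (m : ℕ) : Fin n → F := (((a.Phi ^ m) a.lamHat : a.kerTheta1) : Fin n → F)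

/-- The frame `e₁ = λ̂, e₂ = Φ e₁, …, e_{n-1} = Φ e_{n-2}, e_n = δ` (the radial field), with indices
shifted to start at `0`; row `i` holds the coordinates of the `i`-th vector. -/
def frame : Matrix (Fin n) (Fin n) F :=
  Matrix.of fun i => if (i : ℕ) + 1 = n then a.x else a.krylov i

/-- Regular 3-jets: `u ≠ 0`, the quadratic form `Θ₂` is nondegenerate, and `e₁, …, e_{n-1}` are
linearly independent. -/
def Regular : Prop :=
  a.u ≠ 0 ∧ (Matrix.of a.u2).det ≠ 0 ∧
    LinearIndependent F (fun i : Fin (n - 1) => a.krylov i)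

end Frame

end Jet3

/-- The bundle `E₃` over `V ∖ {0}`: 3-jets satisfying the Euler equation of degree `k` and its
prolongations. -/
def Euler3 (n k : ℕ) : Set (Jet3 n ℝ) :=
  {a | a.x ≠ 0 ∧
    (∀ i j, a.u2 i j = a.u2 j i) ∧
    (∀ i j l, a.u3 i j l = a.u3 j i l ∧ a.u3 i j l = a.u3 i l j) ∧
    ∑ i, a.x i * a.u1 i = (k : ℝ) * a.u ∧
    (∀ j, ∑ i, a.x i * a.u2 i j = ((k : ℝ) - 1) * a.u1 j) ∧
    (∀ j l, ∑ i, a.x i * a.u3 i j l = ((k : ℝ) - 2) * a.u2 j l)}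

/-- A fraction `P / Q` of polynomials in the jet coordinates of order at most 3. -/
structure JetFraction (n : ℕ) where
  num : MvPolynomial (Coord n) ℝ
  den : MvPolynomial (Coord n) ℝ

/-- The fraction `P / Q` is a `GL(n, ℝ)`-invariant rational function on `E₃`: the denominator does
not vanish identically on `E₃`, and `P(A a) / Q(A a) = P(a) / Q(a)` as rational functions of
`a ∈ E₃`, for every `A`. -/
def JetFraction.IsInvariant {n : ℕ} (k : ℕ) (I : JetFraction n) : Prop :=
  (∃ a ∈ Euler3 n k, MvPolynomial.eval a.coord I.den ≠ 0) ∧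
  ∀ A : GL (Fin n) ℝ, ∀ a ∈ Euler3 n k,
    MvPolynomial.eval (a.act A).coord I.num * MvPolynomial.eval a.coord I.den =
      MvPolynomial.eval a.coord I.num * MvPolynomial.eval (a.act A).coord I.den

/-- The invariant `Θ₀ = u`. -/
def theta0 (n : ℕ) : JetFraction n := ⟨MvPolynomial.X Coord.u, 1⟩

/-- A system `J₁, …, J_n` of rational differential invariants of order at most 3 with
`J_n = Θ₀`. -/
def IsInvariantSystem {n : ℕ} (k : ℕ) (I : Fin n → JetFraction n) : Prop :=
  (∀ i, (I i).IsInvariant k) ∧ ∀ i : Fin n, (i : ℕ) + 1 = n → I i = theta0 n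

/-- The 3-jet of the polynomial `h`, with entries transported by a ring homomorphism `φ`: for
`φ` the evaluation at `v` this is the 3-jet of `h` at the point `v`; for the inclusion of polynomials
into rational functions it is the 3-jet of `h` at a variable point. -/
def jetOf {n : ℕ} {F : Type} [CommRing F] (φ : MvPolynomial (Fin n) ℝ →+* F)
    (h : MvPolynomial (Fin n) ℝ) : Jet3 n F where
  x i := φ (MvPolynomial.X i)
  u := φ h
  u1 i := φ (MvPolynomial.pderiv i h)
  u2 i j := φ (MvPolynomial.pderiv i (MvPolynomial.pderiv j h))
  u3 i j l := φ (MvPolynomial.pderiv i (MvPolynomial.pderiv j (MvPolynomial.pderiv l h)))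

/-- The 3-jet of `h` at the point `v`. -/
abbrev jetAt {n : ℕ} (h : MvPolynomial (Fin n) ℝ) (v : Fin n → ℝ) : Jet3 n ℝ :=
  jetOf (MvPolynomial.eval v) h

/-- The value at the point `v` of the invariant `I` on the form `h`. -/
def JetFraction.valueAt {n : ℕ} (I : JetFraction n) (h : MvPolynomial (Fin n) ℝ)
    (v : Fin n → ℝ) : ℝ :=
  MvPolynomial.eval (jetAt h v).coord I.num / MvPolynomial.eval (jetAt h v).coord I.den

/-- Regular forms of degree `k`: for some `v ≠ 0` the 4-jet of `h` at `v` is regular, that is, the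
3-jet of `h` at `v` is regular and some invariants `J₁, …, J_n = Θ₀` of order at most 3, defined at
this 3-jet, have total differentials that are linearly independent at the 4-jet. (The total
differential of `J` at the 4-jet of `h` at `v` is the differential of `J(h)` at `v`.) -/
def IsRegularForm {n : ℕ} (k : ℕ) (h : MvPolynomial (Fin n) ℝ) : Prop :=
  h.IsHomogeneous k ∧
  ∃ v : Fin n → ℝ, v ≠ 0 ∧ (jetAt h v).Regular ∧
    ∃ I : Fin n → JetFraction n, IsInvariantSystem k I ∧
      (∀ i, MvPolynomial.eval (jetAt h v).coord (I i).den ≠ 0) ∧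
      LinearIndependent ℝ (fun i => fderiv ℝ ((I i).valueAt h) v)

/-- The field of rational functions on `V = ℝⁿ`. -/
abbrev RatFn (n : ℕ) : Type := FractionRing (MvPolynomial (Fin n) ℝ)

/-- The partial derivative of a rational function, by the quotient rule. -/
def RatFn.pderiv {n : ℕ} (i : Fin n) (f : RatFn n) : RatFn n :=
  let p : MvPolynomial (Fin n) ℝ := IsFractionRing.num (MvPolynomial (Fin n) ℝ) f
  let q : MvPolynomial (Fin n) ℝ := (IsFractionRing.den (MvPolynomial (Fin n) ℝ) f).val
  algebraMap _ (RatFn n) (MvPolynomial.pderiv i p * q - p * MvPolynomial.pderiv i q) /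
    algebraMap _ (RatFn n) (q ^ 2)

/-- The quotient rule for `RatFn.pderiv`, for an arbitrary representation as a fraction. -/
theorem RatFn.pderiv_div {n : ℕ} (i : Fin n) (p q : MvPolynomial (Fin n) ℝ) (hq : q ≠ 0) :
    RatFn.pderiv i (algebraMap _ (RatFn n) p / algebraMap _ (RatFn n) q) =
      algebraMap _ (RatFn n) (MvPolynomial.pderiv i p * q - p * MvPolynomial.pderiv i q) /
        algebraMap _ (RatFn n) (q ^ 2) := by
  set f : RatFn n := algebraMap _ (RatFn n) p / algebraMap _ (RatFn n) q with hf
  have hinj : Function.Injective (algebraMap (MvPolynomial (Fin n) ℝ) (RatFn n)) :=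
    IsFractionRing.injective _ _
  unfold RatFn.pderiv
  set P : MvPolynomial (Fin n) ℝ := IsFractionRing.num (MvPolynomial (Fin n) ℝ) f with hP
  set Q : MvPolynomial (Fin n) ℝ :=
    (IsFractionRing.den (MvPolynomial (Fin n) ℝ) f).val with hQ
  have hQ0 : Q ≠ 0 := nonZeroDivisors.ne_zero (IsFractionRing.den (MvPolynomial (Fin n) ℝ) f).2
  have hPQ : algebraMap _ (RatFn n) P / algebraMap _ (RatFn n) Q = f :=
    IsFractionRing.mk'_num_den' _ f
  have hne : ∀ r : MvPolynomial (Fin n) ℝ, r ≠ 0 → algebraMap _ (RatFn n) r ≠ 0 := by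
    intro r hr h0
    exact hr (hinj (by rw [h0, map_zero]))
  have hcross : P * q = p * Q := by
    apply hinj
    rw [hf, div_eq_div_iff (hne Q hQ0) (hne q hq)] at hPQ
    rw [map_mul, map_mul]
    exact hPQ
  have hd : MvPolynomial.pderiv i P * q + P * MvPolynomial.pderiv i q =
      MvPolynomial.pderiv i p * Q + p * MvPolynomial.pderiv i Q := by
    have := congrArg (MvPolynomial.pderiv i) hcross
    simp only [Derivation.leibniz, smul_eq_mul] at this
    linear_combination this
  rw [div_eq_div_iff (hne _ (pow_ne_zero 2 hQ0)) (hne _ (pow_ne_zero 2 hq)), ← map_mul, ← map_mul]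
  congr 1
  linear_combination (q * Q) * hd - (MvPolynomial.pderiv i q * Q + q * MvPolynomial.pderiv i Q) *
    hcross

/-- The rational function `f` is defined at `v`, with value `c`: it has a representation as a
fraction whose denominator does not vanish at `v`. -/
def RatFn.HasValue {n : ℕ} (f : RatFn n) (v : Fin n → ℝ) (c : ℝ) : Prop :=
  ∃ p q : MvPolynomial (Fin n) ℝ, MvPolynomial.eval v q ≠ 0 ∧
    f = algebraMap _ (RatFn n) p / algebraMap _ (RatFn n) q ∧
    c = MvPolynomial.eval v p / MvPolynomial.eval v q

/-- The 3-jet of `h` at a variable point. -/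
abbrev jetVar {n : ℕ} (h : MvPolynomial (Fin n) ℝ) : Jet3 n (RatFn n) :=
  jetOf (algebraMap _ (RatFn n)) h

/-- The value `I(h)` of the invariant `I` on `h`, a rational function on `V`. -/
def JetFraction.value {n : ℕ} (I : JetFraction n) (h : MvPolynomial (Fin n) ℝ) : RatFn n :=
  MvPolynomial.aeval (jetVar h).coord I.num / MvPolynomial.aeval (jetVar h).coord I.den

/-- The invariants `I` are in general position along `h`: the denominators do not vanish
identically along `h`, and the differentials of the rational functions `I₁(h), …, I_n(h)` are
linearly independent, that is, `dI₁(h) ∧ ⋯ ∧ dI_n(h) ≠ 0`. -/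
def InGeneralPositionAlong {n : ℕ} (I : Fin n → JetFraction n) (h : MvPolynomial (Fin n) ℝ) :
    Prop :=
  (∀ i, MvPolynomial.aeval (jetVar h).coord (I i).den ≠ 0) ∧
  LinearIndependent (RatFn n) (fun i => fun j : Fin n => RatFn.pderiv j ((I i).value h))

/-- The invariant frame along `h`, made of rational vector fields on `V`. -/
def frameOf {n : ℕ} (h : MvPolynomial (Fin n) ℝ) : Matrix (Fin n) (Fin n) (RatFn n) :=
  (jetVar h).frame

/-- The derivative `e_a(f)` of a rational function along a vector of the frame. -/
def frameDeriv {n : ℕ} (h : MvPolynomial (Fin n) ℝ) (a : Fin n) (f : RatFn n) : RatFn n :=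
  ∑ i, frameOf h a i * RatFn.pderiv i f

/-- The functions `U_{ab}(h) = e_a(J_b(h))`. -/
def frameCoeff {n : ℕ} (I : Fin n → JetFraction n) (h : MvPolynomial (Fin n) ℝ)
    (a b : Fin n) : RatFn n :=
  frameDeriv h a ((I b).value h)

/-- The Christoffel symbols of the standard flat connection in the frame:
`∇_{e_a} e_b = ∑_c Γ_{ab}^c e_c`, stored as `christoffel h a b c`. -/
def christoffel {n : ℕ} (h : MvPolynomial (Fin n) ℝ) (a b c : Fin n) : RatFn n :=
  Matrix.vecMul (fun i => frameDeriv h a (frameOf h b i)) (frameOf h)⁻¹ c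

/-- The image `Π_h` of the rational map `D_h : v ↦ (J(h)(v), U(h)(v), Γ(h)(v))`, taken over the
points `v` at which all components are defined. -/
def piImage {n : ℕ} (I : Fin n → JetFraction n) (h : MvPolynomial (Fin n) ℝ) :
    Set ((Fin n → ℝ) × (Fin n → Fin n → ℝ) × (Fin n → Fin n → Fin n → ℝ)) :=
  {p | ∃ v : Fin n → ℝ,
    (∀ i, ((I i).value h).HasValue v (p.1 i)) ∧
    (∀ a b, (frameCoeff I h a b).HasValue v (p.2.1 a b)) ∧
    (∀ a b c, (christoffel h a b c).HasValue v (p.2.2 a b c))}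

/-- `h` and `h'` are `GL(n, ℝ)`-equivalent: `h' = h ∘ A` for some invertible `A`. -/
def Equivalent {n : ℕ} (h h' : MvPolynomial (Fin n) ℝ) : Prop :=
  ∃ A : GL (Fin n) ℝ, ∀ v : Fin n → ℝ,
    MvPolynomial.eval v h' = MvPolynomial.eval (A.val.mulVec v) h

end FormJet

end

/-!
The theorem is proved algebraically, in the field of rational functions on `V = ℝⁿ`; no analytic
inverse function theorem is needed.

*Equivalent forms have the same image.* On jets satisfying the Euler equations the tangent space is
the direct sum of `ker Θ₁` and the radial line, and the sum is orthogonal for `Θ₂`. Hence the tensors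
on `ker Θ₁` which define the frame have explicit expressions in terms of the inverse of the Hessian
(`Transversal.frame_eq`). These expressions commute with ring homomorphisms (`map_ringFrame`) and
with linear changes of coordinates (`pull_ringFrame`). So the substitution `v ↦ A v` carries the
components of the invariant map of `h` to those of `h ∘ A`. The same naturality, applied to the local
ring at a regular point, shows that the frame of a regular form is a basis over the field of rational
functions (`det_frameOf_ne_zero`). For the existence of a system in general position along both
forms, the fractions given along `h` may become `0/0` along `h ∘ A`; they are replaced by general
members of the pencils `(P + t P∘A) / (Q + t Q∘A)` (`exists_common_system`).

*Forms with the same image are equivalent.* If `Π_h = Π_{h'}`, the components of the two maps satisfy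
the same polynomial relations. Call two rational functions corresponding (`Corr`) if they are given
by one rational expression in the components along `h` and along `h'`. Every component is separably
algebraic over the `J_b` (`exists_separable_relation`), and `e_a(J_b) = U_{ab}`; differentiating a
minimal relation shows that the frame derivatives of corresponding functions correspond
(`corr_frameDeriv_comps`). The coefficients of the Taylor expansion `h (x + ∑ sₐ eₐ)` are obtained
from `h = J_n` by frame derivatives and Christoffel symbols (`pderiv_frameTaylor`), so they correspond
too (`corr_coeff_frameTaylor`). Now take one point of the common image at which all the denominators
and `det U` are nonzero. Since `e_n = x`, the expansion at a preimage under either map recovers the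
form as `g ∘ B`, with the same polynomial `g` on both sides (`exists_eq_linSub`); `B` is invertible
because the Hessian of a regular form is not identically degenerate (`det_ne_zero_of_eq_linSub`).
-/

noncomputable section

namespace FormJet

open MvPolynomial

/-! ### Derivations and polynomials -/

/-- The chain rule for a derivation applied to a polynomial expression. -/
theorem derivation_aeval {σ R A : Type*} [CommRing R] [CommRing A] [Algebra R A] [Fintype σ]
    (d : Derivation R A A) (f : σ → A) (p : MvPolynomial σ R) :
    d (aeval f p) = ∑ i, aeval f (pderiv i p) * d (f i) := by
  classical
  induction p using MvPolynomial.induction_on with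
  | C a => simp [← MvPolynomial.algebraMap_eq]
  | add p q hp hq => simp [hp, hq, add_mul, Finset.sum_add_distrib]
  | mul_X p i hp =>
    have key : ∀ j, aeval f (pderiv j (p * X i)) * d (f j) =
        f i * (aeval f (pderiv j p) * d (f j)) +
          if i = j then aeval f p * d (f j) else 0 := by
      intro j
      rcases eq_or_ne i j with h | h
      · subst h; simp [Derivation.leibniz]; ring
      · simp [Derivation.leibniz, pderiv_X_of_ne h, h]; ring
    rw [Finset.sum_congr rfl fun j _ => key j, Finset.sum_add_distrib, ← Finset.mul_sum, ← hp]
    simp only [map_mul, aeval_X, Derivation.leibniz, smul_eq_mul, Finset.sum_ite_eq,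
      Finset.mem_univ, if_true]
    ring

theorem exists_eval_ne_zero {σ : Type*} {p : MvPolynomial σ ℝ} (hp : p ≠ 0) :
    ∃ v, eval v p ≠ 0 := by
  by_contra! h
  exact hp (MvPolynomial.funext fun v => by simp [h v])

/-! ### Rational functions: partial derivatives and values -/

namespace RatFn

variable {n : ℕ}

theorem algebraMap_ne_zero {q : MvPolynomial (Fin n) ℝ} (hq : q ≠ 0) :
    algebraMap (MvPolynomial (Fin n) ℝ) (RatFn n) q ≠ 0 := by
  simpa using hq

theorem exists_eq_div (f : RatFn n) : ∃ p q : MvPolynomial (Fin n) ℝ, q ≠ 0 ∧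
    f = algebraMap _ (RatFn n) p / algebraMap _ (RatFn n) q := by
  obtain ⟨p, q, hq, rfl⟩ := IsFractionRing.div_surjective (MvPolynomial (Fin n) ℝ) f
  exact ⟨p, q, nonZeroDivisors.ne_zero hq, rfl⟩

theorem pderiv_algebraMap (i : Fin n) (p : MvPolynomial (Fin n) ℝ) :
    RatFn.pderiv i (algebraMap _ (RatFn n) p) = algebraMap _ (RatFn n) (MvPolynomial.pderiv i p) := by
  have := RatFn.pderiv_div i p 1 one_ne_zero
  simpa using this

theorem pderiv_add (i : Fin n) (f g : RatFn n) :
    RatFn.pderiv i (f + g) = RatFn.pderiv i f + RatFn.pderiv i g := by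
  obtain ⟨p, q, hq, rfl⟩ := exists_eq_div f
  obtain ⟨r, s, hs, rfl⟩ := exists_eq_div g
  have hq' := algebraMap_ne_zero hq
  have hs' := algebraMap_ne_zero hs
  rw [div_add_div _ _ hq' hs', ← map_mul, ← map_mul, ← map_mul, ← map_add,
    pderiv_div _ _ _ (mul_ne_zero hq hs), pderiv_div _ _ _ hq, pderiv_div _ _ _ hs]
  simp only [Derivation.leibniz, smul_eq_mul, map_add, map_mul, map_sub, map_pow]
  field_simp
  ring

theorem pderiv_mul (i : Fin n) (f g : RatFn n) :
    RatFn.pderiv i (f * g) = f * RatFn.pderiv i g + g * RatFn.pderiv i f := by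
  obtain ⟨p, q, hq, rfl⟩ := exists_eq_div f
  obtain ⟨r, s, hs, rfl⟩ := exists_eq_div g
  have hq' := algebraMap_ne_zero hq
  have hs' := algebraMap_ne_zero hs
  rw [div_mul_div_comm, ← map_mul, ← map_mul,
    pderiv_div _ _ _ (mul_ne_zero hq hs), pderiv_div _ _ _ hq, pderiv_div _ _ _ hs]
  simp only [Derivation.leibniz, smul_eq_mul, map_add, map_mul, map_sub, map_pow]
  field_simp
  ring

theorem algebraMap_real (r : ℝ) :
    algebraMap ℝ (RatFn n) r = algebraMap _ (RatFn n) (C r : MvPolynomial (Fin n) ℝ) :=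
  IsScalarTower.algebraMap_apply ℝ (MvPolynomial (Fin n) ℝ) (RatFn n) r

/-- `RatFn.pderiv` as a derivation. -/
def derivation (i : Fin n) : Derivation ℝ (RatFn n) (RatFn n) :=
  Derivation.mk'
    { toFun := RatFn.pderiv i
      map_add' := pderiv_add i
      map_smul' := fun c f => by
        rw [Algebra.smul_def, algebraMap_real, pderiv_mul, pderiv_algebraMap, pderiv_C, map_zero,
          mul_zero, add_zero, ← algebraMap_real, ← Algebra.smul_def, RingHom.id_apply] }
    (pderiv_mul i)

@[simp] theorem derivation_apply (i : Fin n) (f : RatFn n) : derivation i f = RatFn.pderiv i f := rfl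

variable {v : Fin n → ℝ}

theorem HasValue.add {f g : RatFn n} {c d : ℝ} (hf : f.HasValue v c) (hg : g.HasValue v d) :
    (f + g).HasValue v (c + d) := by
  obtain ⟨p, q, hq, rfl, rfl⟩ := hf
  obtain ⟨r, s, hs, rfl, rfl⟩ := hg
  refine ⟨p * s + q * r, q * s, by simp [hq, hs], ?_, by simp [div_add_div _ _ hq hs]⟩
  have hq' := algebraMap_ne_zero (q := q) (by rintro rfl; simp at hq)
  have hs' := algebraMap_ne_zero (q := s) (by rintro rfl; simp at hs)
  simp [div_add_div _ _ hq' hs']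

theorem HasValue.mul {f g : RatFn n} {c d : ℝ} (hf : f.HasValue v c) (hg : g.HasValue v d) :
    (f * g).HasValue v (c * d) := by
  obtain ⟨p, q, hq, rfl, rfl⟩ := hf
  obtain ⟨r, s, hs, rfl, rfl⟩ := hg
  exact ⟨p * r, q * s, by simp [hq, hs], by simp [div_mul_div_comm], by simp [div_mul_div_comm]⟩

theorem hasValue_algebraMap (p : MvPolynomial (Fin n) ℝ) :
    (algebraMap _ (RatFn n) p).HasValue v (eval v p) :=
  ⟨p, 1, by simp, by simp, by simp⟩

theorem HasValue.unique {f : RatFn n} {c d : ℝ} (hf : f.HasValue v c) (hg : f.HasValue v d) :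
    c = d := by
  obtain ⟨p, q, hq, rfl, rfl⟩ := hf
  obtain ⟨r, s, hs, h, rfl⟩ := hg
  have hq' := algebraMap_ne_zero (q := q) (by rintro rfl; simp at hq)
  have hs' := algebraMap_ne_zero (q := s) (by rintro rfl; simp at hs)
  rw [div_eq_div_iff hq' hs', ← map_mul, ← map_mul] at h
  have := congrArg (eval v) (IsFractionRing.injective (MvPolynomial (Fin n) ℝ) (RatFn n) h)
  rw [div_eq_div_iff hq hs, ← map_mul, ← map_mul, this]

theorem HasValue.inv {f : RatFn n} {c : ℝ} (hf : f.HasValue v c) (hc : c ≠ 0) :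
    f⁻¹.HasValue v c⁻¹ := by
  obtain ⟨p, q, hq, rfl, rfl⟩ := hf
  exact ⟨q, p, fun h => hc (by simp [h]), by simp, by simp⟩

theorem HasValue.pderiv {f : RatFn n} {c : ℝ} (hf : f.HasValue v c) (i : Fin n) :
    ∃ d, (RatFn.pderiv i f).HasValue v d := by
  obtain ⟨p, q, hq, rfl, rfl⟩ := hf
  exact ⟨_, _, _, by simpa using hq, pderiv_div i p q (by rintro rfl; simp at hq), rfl⟩

/-- The local ring of rational functions defined at `v`, presented as the algebra of pairs
`(f, f(v))`; its two projections are the inclusion into the field of rational functions and the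
evaluation at `v`. -/
def valueSubalgebra (v : Fin n → ℝ) : Subalgebra ℝ (RatFn n × ℝ) where
  carrier := {z | z.1.HasValue v z.2}
  mul_mem' := HasValue.mul
  add_mem' := HasValue.add
  algebraMap_mem' r := by
    have := hasValue_algebraMap (v := v) (C r)
    rw [← MvPolynomial.algebraMap_eq, ← IsScalarTower.algebraMap_apply] at this
    simpa using this

@[simp] theorem mem_valueSubalgebra {z : RatFn n × ℝ} :
    z ∈ valueSubalgebra v ↔ z.1.HasValue v z.2 := Iff.rfl

/-- The inclusion of the local ring at `v` into the field of rational functions. -/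
def toRatFn (v : Fin n → ℝ) : valueSubalgebra v →ₐ[ℝ] RatFn n :=
  (AlgHom.fst ℝ (RatFn n) ℝ).comp (valueSubalgebra v).val

/-- Evaluation at `v` on the local ring at `v`. -/
def toReal (v : Fin n → ℝ) : valueSubalgebra v →ₐ[ℝ] ℝ :=
  (AlgHom.snd ℝ (RatFn n) ℝ).comp (valueSubalgebra v).val

theorem hasValue_toRatFn (z : valueSubalgebra v) : (toRatFn v z).HasValue v (toReal v z) := z.2

/-- The element of the local ring at `v` given by a rational function with a value at `v`. -/
def HasValue.lift {f : RatFn n} {c : ℝ} (hf : f.HasValue v c) : valueSubalgebra v := ⟨(f, c), hf⟩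

@[simp] theorem toRatFn_lift {f : RatFn n} {c : ℝ} (hf : f.HasValue v c) :
    toRatFn v hf.lift = f := rfl

@[simp] theorem toReal_lift {f : RatFn n} {c : ℝ} (hf : f.HasValue v c) :
    toReal v hf.lift = c := rfl

theorem toRatFn_injective (v : Fin n → ℝ) : Function.Injective (toRatFn v) := by
  rintro ⟨⟨f, c⟩, hf⟩ ⟨⟨g, d⟩, hg⟩ (h : f = g)
  subst h
  simp only [Subtype.mk.injEq, Prod.mk.injEq, true_and]
  exact HasValue.unique hf hg

theorem isUnit_of_toReal_ne_zero {z : valueSubalgebra v} (hz : toReal v z ≠ 0) : IsUnit z := by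
  have hinv := (hasValue_toRatFn z).inv hz
  refine IsUnit.of_mul_eq_one hinv.lift (toRatFn_injective v ?_)
  have h0 : toRatFn v z ≠ 0 := by
    intro h
    have := hasValue_toRatFn z
    rw [h] at this
    have h2 := hasValue_algebraMap (v := v) (0 : MvPolynomial (Fin n) ℝ)
    rw [map_zero, map_zero] at h2
    exact hz (this.unique h2)
  simp [h0]

theorem HasValue.aeval {ι : Type*} {D : ι → RatFn n} {c : ι → ℝ}
    (h : ∀ i, (D i).HasValue v (c i)) (P : MvPolynomial ι ℝ) :
    (MvPolynomial.aeval D P).HasValue v (eval c P) := by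
  have := hasValue_toRatFn (MvPolynomial.aeval (fun i => (h i).lift) P)
  rw [← AlgHom.comp_apply, ← AlgHom.comp_apply, comp_aeval, comp_aeval] at this
  simpa [MvPolynomial.aeval_eq_eval] using this

theorem HasValue.sum {ι : Type*} {s : Finset ι} {D : ι → RatFn n} {c : ι → ℝ}
    (h : ∀ i ∈ s, (D i).HasValue v (c i)) : (∑ i ∈ s, D i).HasValue v (∑ i ∈ s, c i) := by
  have : ∑ i ∈ s, ((D i, c i) : RatFn n × ℝ) ∈ valueSubalgebra v := sum_mem h
  simpa [Prod.fst_sum, Prod.snd_sum] using this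

theorem HasValue.prod {ι : Type*} {s : Finset ι} {D : ι → RatFn n} {c : ι → ℝ}
    (h : ∀ i ∈ s, (D i).HasValue v (c i)) : (∏ i ∈ s, D i).HasValue v (∏ i ∈ s, c i) := by
  have : ∏ i ∈ s, ((D i, c i) : RatFn n × ℝ) ∈ valueSubalgebra v := prod_mem h
  simpa [Prod.fst_prod, Prod.snd_prod] using this

theorem HasValue.pow {f : RatFn n} {c : ℝ} (hf : f.HasValue v c) (m : ℕ) :
    (f ^ m).HasValue v (c ^ m) := (hf.lift ^ m).2

/-- A finite family of rational functions is defined at some point where a given nonzero polynomial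
expression in the family does not vanish. -/
theorem exists_hasValue_eval_ne_zero {ι : Type*} [Fintype ι] (D : ι → RatFn n)
    {R : MvPolynomial ι ℝ} (hR : MvPolynomial.aeval D R ≠ 0) :
    ∃ (v : Fin n → ℝ) (c : ι → ℝ), (∀ i, (D i).HasValue v (c i)) ∧ eval c R ≠ 0 := by
  choose p q hq hD using fun i => exists_eq_div (D i)
  obtain ⟨r, s, hs, hrs⟩ := exists_eq_div (MvPolynomial.aeval D R)
  have hr : r ≠ 0 := by rintro rfl; simp [hrs] at hR
  obtain ⟨v, hv⟩ := exists_eval_ne_zero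
    (mul_ne_zero (mul_ne_zero (Finset.prod_ne_zero_iff.2 fun i _ => hq i) hr) hs)
  simp only [map_mul, map_prod, mul_ne_zero_iff, Finset.prod_ne_zero_iff] at hv
  have hD' : ∀ i, (D i).HasValue v (eval v (p i) / eval v (q i)) := fun i =>
    ⟨p i, q i, hv.1.1 i (Finset.mem_univ i), hD i, rfl⟩
  refine ⟨v, _, hD', ?_⟩
  have h2 : (MvPolynomial.aeval D R).HasValue v (eval v r / eval v s) := ⟨r, s, hv.2, hrs, rfl⟩
  rw [(HasValue.aeval hD' R).unique h2]
  exact div_ne_zero hv.1.2 hv.2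

end RatFn

/-! ### Linear substitutions -/

variable {n : ℕ}

/-- Composition of polynomials with the linear map of matrix `A`. -/
def linSub (A : Matrix (Fin n) (Fin n) ℝ) :
    MvPolynomial (Fin n) ℝ →ₐ[ℝ] MvPolynomial (Fin n) ℝ :=
  aeval fun i => ∑ j, C (A i j) * X j

@[simp] theorem linSub_X (A : Matrix (Fin n) (Fin n) ℝ) (i : Fin n) :
    linSub A (X i) = ∑ j, C (A i j) * X j := by simp [linSub]

theorem eval_linSub (A : Matrix (Fin n) (Fin n) ℝ) (p : MvPolynomial (Fin n) ℝ) (v : Fin n → ℝ) :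
    eval v (linSub A p) = eval (A.mulVec v) p := by
  induction p using MvPolynomial.induction_on with
  | C a => simp [linSub]
  | add p q hp hq => simp [hp, hq]
  | mul_X p i hp => simp [hp, Matrix.mulVec, dotProduct]

theorem pderiv_linSub (A : Matrix (Fin n) (Fin n) ℝ) (p : MvPolynomial (Fin n) ℝ) (i : Fin n) :
    pderiv i (linSub A p) = ∑ j, C (A j i) * linSub A (pderiv j p) := by
  classical
  rw [linSub, derivation_aeval]
  refine Finset.sum_congr rfl fun j _ => ?_
  have : (pderiv i) (∑ l, C (A j l) * X l : MvPolynomial (Fin n) ℝ) = C (A j i) := by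
    simp [Derivation.leibniz, pderiv_X, Pi.single_apply]
  rw [this, mul_comm]

theorem linSub_injective (A : GL (Fin n) ℝ) : Function.Injective (linSub A.val) := by
  intro p q h
  refine MvPolynomial.funext fun v => ?_
  have := congrArg (eval ((A⁻¹).val.mulVec v)) h
  simpa [eval_linSub, Matrix.mulVec_mulVec, ← Units.val_mul] using this

/-- Composition of rational functions with an invertible linear map. -/
def ratSub (A : GL (Fin n) ℝ) : RatFn n →ₐ[ℝ] RatFn n :=
  IsFractionRing.liftAlgHom (g := (IsScalarTower.toAlgHom ℝ (MvPolynomial (Fin n) ℝ) (RatFn n)).comp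
    (linSub A.val)) ((IsFractionRing.injective _ _).comp (linSub_injective A))

@[simp] theorem ratSub_algebraMap (A : GL (Fin n) ℝ) (p : MvPolynomial (Fin n) ℝ) :
    ratSub A (algebraMap _ (RatFn n) p) = algebraMap _ (RatFn n) (linSub A.val p) :=
  IsFractionRing.lift_algebraMap (g := (((IsScalarTower.toAlgHom ℝ (MvPolynomial (Fin n) ℝ)
    (RatFn n)).comp (linSub A.val) : MvPolynomial (Fin n) ℝ →ₐ[ℝ] RatFn n) :
      MvPolynomial (Fin n) ℝ →+* RatFn n))
    ((IsFractionRing.injective _ _).comp (linSub_injective A)) p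

theorem RatFn.HasValue.ratSub (A : GL (Fin n) ℝ) {f : RatFn n} {v : Fin n → ℝ} {c : ℝ}
    (hf : f.HasValue (A.val.mulVec v) c) : (FormJet.ratSub A f).HasValue v c := by
  obtain ⟨p, q, hq, rfl, rfl⟩ := hf
  exact ⟨linSub A.val p, linSub A.val q, by rwa [eval_linSub], by simp, by simp [eval_linSub]⟩

theorem pderiv_ratSub (A : GL (Fin n) ℝ) (f : RatFn n) (i : Fin n) :
    RatFn.pderiv i (ratSub A f) =
      ∑ j, algebraMap ℝ (RatFn n) (A.val j i) * ratSub A (RatFn.pderiv j f) := by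
  obtain ⟨p, q, hq, rfl⟩ := RatFn.exists_eq_div f
  have hq' : linSub A.val q ≠ 0 := fun h => hq (linSub_injective A (by simpa using h))
  have key : pderiv i (linSub A.val p) * linSub A.val q -
      linSub A.val p * pderiv i (linSub A.val q) =
      ∑ j, C (A.val j i) * linSub A.val (pderiv j p * q - p * pderiv j q) := by
    rw [pderiv_linSub, pderiv_linSub, Finset.sum_mul, Finset.mul_sum, ← Finset.sum_sub_distrib]
    refine Finset.sum_congr rfl fun j _ => ?_
    rw [map_sub, map_mul, map_mul]
    ring
  have hj : ∀ j, algebraMap ℝ (RatFn n) (A.val j i) * ratSub A (RatFn.pderiv j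
        (algebraMap _ (RatFn n) p / algebraMap _ (RatFn n) q)) =
      algebraMap _ (RatFn n) (C (A.val j i) * linSub A.val (pderiv j p * q - p * pderiv j q)) /
        algebraMap _ (RatFn n) (linSub A.val q ^ 2) := by
    intro j
    rw [RatFn.pderiv_div _ _ _ hq, map_div₀, ratSub_algebraMap, ratSub_algebraMap,
      RatFn.algebraMap_real, ← mul_div_assoc, ← map_mul, map_pow (linSub A.val)]
  rw [Finset.sum_congr rfl fun j _ => hj j, ← Finset.sum_div, ← map_sum, ← key, map_div₀,
    ratSub_algebraMap, ratSub_algebraMap, RatFn.pderiv_div _ _ _ hq']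

/-! ### The frame in coordinates -/

namespace Jet3

section Pull

variable {R R' : Type}

/-- The jet with entries transported along a map. -/
def map (f : R → R') (a : Jet3 n R) : Jet3 n R' where
  x i := f (a.x i)
  u := f a.u
  u1 i := f (a.u1 i)
  u2 i j := f (a.u2 i j)
  u3 i j l := f (a.u3 i j l)

variable [CommRing R]

/-- The matrix of the bilinear form `(X, Y) ↦ ∑ uᵢⱼₗ Zᵢ Xⱼ Yₗ`, with the row index `l`. -/
def slice (a : Jet3 n R) (Z : Fin n → R) : Matrix (Fin n) (Fin n) R :=
  Matrix.of fun l j => ∑ i, Z i * a.u3 i j l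

/-- The projection along the radial vector `x` onto `ker Θ₁`, composed with the matrix `G`. Here `G`
stands for the inverse of the Hessian and `c` for the inverse of `Θ₁(x)`. -/
def projInv (a : Jet3 n R) (G : Matrix (Fin n) (Fin n) R) (c : R) : Matrix (Fin n) (Fin n) R :=
  (1 - c • Matrix.vecMulVec a.x a.u1) * G

/-- The pullback of a jet along the linear map `B`: the prolonged action of `B⁻¹ = Binv` over an
arbitrary ring. -/
def pull (B Binv : Matrix (Fin n) (Fin n) R) (a : Jet3 n R) : Jet3 n R where
  x := Binv.mulVec a.x
  u := a.u
  u1 i := ∑ p, a.u1 p * B p i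
  u2 i j := ∑ p, ∑ q, a.u2 p q * B p i * B q j
  u3 i j l := ∑ p, ∑ q, ∑ r, a.u3 p q r * B p i * B q j * B r l

variable {B Binv : Matrix (Fin n) (Fin n) R} (a : Jet3 n R) (G : Matrix (Fin n) (Fin n) R) (c : R)

theorem pull_u1 (B Binv : Matrix (Fin n) (Fin n) R) : (a.pull B Binv).u1 = Matrix.vecMul a.u1 B := by
  ext i; simp [pull, Matrix.vecMul, dotProduct]

theorem pull_hess (B Binv : Matrix (Fin n) (Fin n) R) :
    Matrix.of (a.pull B Binv).u2 = B.transpose * Matrix.of a.u2 * B := by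
  ext i j
  simp only [pull, Matrix.of_apply, Matrix.mul_apply, Matrix.transpose_apply, Finset.sum_mul]
  rw [Finset.sum_comm]
  exact Finset.sum_congr rfl fun q _ => Finset.sum_congr rfl fun p _ => by ring

theorem pull_slice (hB : B * Binv = 1) (Z : Fin n → R) :
    (a.pull B Binv).slice (Binv.mulVec Z) = B.transpose * a.slice Z * B := by
  have h : ∀ p, ∑ i, Binv.mulVec Z i * B p i = Z p := by
    intro p
    have := congrFun (congrArg (fun M => Matrix.mulVec M Z) hB) p
    simp only [← Matrix.mulVec_mulVec, Matrix.one_mulVec] at this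
    rw [← this, Matrix.mulVec, dotProduct]
    exact Finset.sum_congr rfl fun i _ => mul_comm _ _
  ext l j
  simp only [slice, pull, Matrix.of_apply, Matrix.mul_apply, Matrix.transpose_apply]
  calc ∑ i, Binv.mulVec Z i * ∑ p, ∑ q, ∑ r, a.u3 p q r * B p i * B q j * B r l
      = ∑ p, ∑ q, ∑ r, (∑ i, Binv.mulVec Z i * B p i) * a.u3 p q r * B q j * B r l := by
        simp only [Finset.mul_sum, Finset.sum_mul]
        rw [Finset.sum_comm]
        refine Finset.sum_congr rfl fun p _ => ?_
        rw [Finset.sum_comm]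
        refine Finset.sum_congr rfl fun q _ => ?_
        rw [Finset.sum_comm]
        exact Finset.sum_congr rfl fun r _ => Finset.sum_congr rfl fun i _ => by ring
    _ = ∑ q, ∑ r, ∑ p, B r l * (Z p * a.u3 p q r) * B q j := by
        simp only [h]
        rw [Finset.sum_comm]
        refine Finset.sum_congr rfl fun q _ => ?_
        rw [Finset.sum_comm]
        exact Finset.sum_congr rfl fun r _ => Finset.sum_congr rfl fun p _ => by ring
    _ = _ := by
        simp only [Finset.mul_sum, Finset.sum_mul]

theorem projInv_mulVec (η : Fin n → R) : (a.projInv G c).mulVec η =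
    G.mulVec η - (c * (a.u1 ⬝ᵥ G.mulVec η)) • a.x := by
  rw [projInv, ← Matrix.mulVec_mulVec, Matrix.sub_mulVec, Matrix.one_mulVec, Matrix.smul_mulVec,
    Matrix.vecMulVec_mulVec, mul_smul]
  simp

theorem pull_projInv (hB : B * Binv = 1) :
    (a.pull B Binv).projInv (Binv * G * Binv.transpose) c =
      Binv * a.projInv G c * Binv.transpose := by
  have h' : Binv * B = 1 := mul_eq_one_comm.1 hB
  have h2 : Matrix.vecMulVec (a.pull B Binv).x (a.pull B Binv).u1 =
      Binv * Matrix.vecMulVec a.x a.u1 * B := by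
    rw [pull_u1, Matrix.mul_vecMulVec, Matrix.vecMulVec_mul]; rfl
  have h3 : (1 : Matrix (Fin n) (Fin n) R) - c • (Binv * Matrix.vecMulVec a.x a.u1 * B) =
      Binv * (1 - c • Matrix.vecMulVec a.x a.u1) * B := by
    rw [mul_sub, sub_mul, mul_one, h', Matrix.mul_smul, Matrix.smul_mul]
  rw [projInv, h2, h3, projInv]
  calc _ = Binv * (1 - c • Matrix.vecMulVec a.x a.u1) * (B * Binv) * G * Binv.transpose := by
        simp only [mul_assoc]
    _ = _ := by rw [hB]; simp only [mul_assoc, one_mul]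

end Pull

section Explicit

variable {R R' : Type} [CommRing R] [CommRing R'] [Algebra ℝ R] [Algebra ℝ R']

/-- The matrix of an extension of `raise Z` to the whole space, with values in `ker Θ₁`. -/
def raiseMatrix (a : Jet3 n R) (G : Matrix (Fin n) (Fin n) R) (c : R) (Z : Fin n → R) :
    Matrix (Fin n) (Fin n) R :=
  (1 / 3 : ℝ) • (a.projInv G c * a.slice Z)

/-- The coordinates of `λ̂`. -/
def lamVec (a : Jet3 n R) (G : Matrix (Fin n) (Fin n) R) (c : R) : Fin n → R :=
  (2 : ℝ) • (a.projInv G c).mulVec fun i => (a.raiseMatrix G c (Pi.single i 1)).trace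

/-- The frame as a polynomial expression in the jet, the inverse `G` of the Hessian and the inverse
`c` of `Θ₁(x)`; unlike `frame` it makes sense over every commutative ring. -/
def ringFrame (a : Jet3 n R) (G : Matrix (Fin n) (Fin n) R) (c : R) : Matrix (Fin n) (Fin n) R :=
  Matrix.of fun i => if (i : ℕ) + 1 = n then a.x else
    (a.raiseMatrix G c (a.lamVec G c) ^ (i : ℕ)).mulVec (a.lamVec G c)

variable (f : R →ₐ[ℝ] R') (a : Jet3 n R) (G : Matrix (Fin n) (Fin n) R) (c : R)

theorem map_slice (Z : Fin n → R) : (a.slice Z).map f = (a.map f).slice (f ∘ Z) := by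
  ext l j; simp [slice, map]

theorem map_projInv : (a.projInv G c).map f = (a.map f).projInv (G.map f) (f c) := by
  ext i j
  simp [projInv, map, Matrix.mul_apply, Matrix.vecMulVec_apply, Matrix.one_apply, apply_ite f]

theorem map_raiseMatrix (Z : Fin n → R) :
    (a.raiseMatrix G c Z).map f = (a.map f).raiseMatrix (G.map f) (f c) (f ∘ Z) := by
  rw [raiseMatrix, raiseMatrix, ← map_projInv, ← map_slice]
  ext i j
  simp [Matrix.mul_apply]

theorem map_lamVec : f ∘ a.lamVec G c = (a.map f).lamVec (G.map f) (f c) := by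
  have h : ∀ i : Fin n, (f ∘ (Pi.single i 1 : Fin n → R)) = (Pi.single i 1 : Fin n → R') := by
    intro i; ext j; simp [Pi.single_apply, apply_ite f]
  ext i
  simp only [lamVec, ← map_projInv, ← h, ← map_raiseMatrix]
  simp [Matrix.mulVec, dotProduct, Matrix.trace]

/-- The expression `ringFrame` commutes with ring homomorphisms. -/
theorem map_ringFrame : (a.ringFrame G c).map f = (a.map f).ringFrame (G.map f) (f c) := by
  ext i j
  simp only [ringFrame, ← map_lamVec, ← map_raiseMatrix, Matrix.map_apply, Matrix.of_apply]
  split_ifs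
  · simp [map]
  · have hp : ∀ (M : Matrix (Fin n) (Fin n) R) (m : ℕ), (M.map f) ^ m = (M ^ m).map f := fun M m =>
      (map_pow (RingHom.mapMatrix (f : R →+* R')) M m).symm
    rw [hp]
    exact (RingHom.map_mulVec (f : R →+* R') _ _ j)

theorem pull_raiseMatrix {B Binv : Matrix (Fin n) (Fin n) R} (hB : B * Binv = 1)
    (Z : Fin n → R) :
    (a.pull B Binv).raiseMatrix (Binv * G * Binv.transpose) c (Binv.mulVec Z) =
      Binv * a.raiseMatrix G c Z * B := by
  have hT : Binv.transpose * B.transpose = 1 := by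
    rw [← Matrix.transpose_mul, hB, Matrix.transpose_one]
  rw [raiseMatrix, pull_projInv a G c hB, pull_slice a hB, raiseMatrix, Matrix.mul_smul,
    Matrix.smul_mul]
  congr 1
  calc _ = Binv * a.projInv G c * (Binv.transpose * B.transpose) * a.slice Z * B := by
        simp only [mul_assoc]
    _ = _ := by rw [hT]; simp only [mul_assoc, one_mul]

theorem raiseMatrix_sum {ι : Type*} (s : Finset ι) (r : ι → R) (Z : ι → Fin n → R) :
    a.raiseMatrix G c (∑ i ∈ s, r i • Z i) = ∑ i ∈ s, r i • a.raiseMatrix G c (Z i) := by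
  have : a.slice (∑ i ∈ s, r i • Z i) = ∑ i ∈ s, r i • a.slice (Z i) := by
    ext l j
    simp only [slice, Matrix.of_apply, Finset.sum_apply, Pi.smul_apply, smul_eq_mul, Finset.sum_mul,
      Matrix.sum_apply, Matrix.smul_apply, Finset.mul_sum]
    rw [Finset.sum_comm]
    simp only [mul_assoc]
  simp only [raiseMatrix, this, Matrix.mul_sum, Finset.smul_sum, Matrix.mul_smul]
  exact Finset.sum_congr rfl fun i _ => smul_comm _ _ _

theorem pull_lamVec {B Binv : Matrix (Fin n) (Fin n) R} (hB : B * Binv = 1) :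
    (a.pull B Binv).lamVec (Binv * G * Binv.transpose) c = Binv.mulVec (a.lamVec G c) := by
  have h' : Binv * B = 1 := mul_eq_one_comm.1 hB
  have hT : Binv.transpose * B.transpose = 1 := by
    rw [← Matrix.transpose_mul, hB, Matrix.transpose_one]
  have key : (fun i => ((a.pull B Binv).raiseMatrix (Binv * G * Binv.transpose) c
      (Pi.single i 1)).trace) =
      B.transpose.mulVec fun i => (a.raiseMatrix G c (Pi.single i 1)).trace := by
    ext i
    have h1 : (Pi.single i 1 : Fin n → R) = Binv.mulVec (∑ p, B p i • Pi.single p 1) := by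
      have : (∑ p, B p i • Pi.single p 1 : Fin n → R) = B.mulVec (Pi.single i 1) := by
        ext q; simp [Finset.sum_apply, Pi.single_apply, Matrix.mulVec, dotProduct]
      rw [this, Matrix.mulVec_mulVec, h', Matrix.one_mulVec]
    rw [h1, pull_raiseMatrix a G c hB, Matrix.trace_mul_comm, ← mul_assoc, hB, one_mul,
      raiseMatrix_sum a G c, Matrix.trace_sum]
    simp [Matrix.mulVec, dotProduct]
  rw [lamVec, key, pull_projInv a G c hB, Matrix.mulVec_mulVec, mul_assoc, hT, mul_one,
    ← Matrix.mulVec_mulVec, ← Matrix.mulVec_smul, lamVec]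

/-- The frame is natural under linear changes of coordinates. -/
theorem pull_ringFrame {B Binv : Matrix (Fin n) (Fin n) R} (hB : B * Binv = 1) :
    (a.pull B Binv).ringFrame (Binv * G * Binv.transpose) c =
      a.ringFrame G c * Binv.transpose := by
  have hpow : ∀ (M : Matrix (Fin n) (Fin n) R) (m : ℕ),
      (Binv * M * B) ^ m * Binv = Binv * M ^ m := by
    intro M m
    induction m with
    | zero => simp
    | succ m ih =>
      rw [pow_succ', mul_assoc, ih, pow_succ']
      calc _ = Binv * M * (B * Binv) * M ^ m := by simp only [mul_assoc]
        _ = _ := by rw [hB, mul_one, mul_assoc]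
  ext i j
  have hrow : (a.ringFrame G c * Binv.transpose) i j = Binv.mulVec (a.ringFrame G c i) j := by
    simp [Matrix.mul_apply, Matrix.mulVec, dotProduct, mul_comm]
  have hrow' : (a.pull B Binv).ringFrame (Binv * G * Binv.transpose) c i =
      Binv.mulVec (a.ringFrame G c i) := by
    rw [ringFrame, ringFrame, pull_lamVec a G c hB, pull_raiseMatrix a G c hB]
    change (if (i : ℕ) + 1 = n then _ else _) = Binv.mulVec (if (i : ℕ) + 1 = n then _ else _)
    split_ifs
    · rfl
    · rw [Matrix.mulVec_mulVec, hpow, ← Matrix.mulVec_mulVec]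
  rw [hrow, hrow']

end Explicit

/-! ### The frame of a jet satisfying the Euler equations -/

section Field

variable {F : Type} [Field F]

/-- The nondegeneracy and the part of the Euler equations on which the coordinate formula for the
frame rests: `Θ₂` is symmetric and nondegenerate, `x` is transversal to `ker Θ₁`, and `x` is
`Θ₂`-orthogonal to `ker Θ₁`. -/
structure Transversal (a : Jet3 n F) : Prop where
  symm : ∀ i j, a.u2 i j = a.u2 j i
  det_ne_zero : (Matrix.of a.u2).det ≠ 0
  radial_ne_zero : a.u1 ⬝ᵥ a.x ≠ 0
  euler : ∃ κ : F, ∀ j, ∑ i, a.x i * a.u2 i j = κ * a.u1 j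

variable (a : Jet3 n F)

theorem mem_kerTheta1 {X : Fin n → F} : X ∈ a.kerTheta1 ↔ a.u1 ⬝ᵥ X = 0 := by
  simp [kerTheta1, dotProduct]

theorem theta20_apply (X Y : a.kerTheta1) :
    a.theta20 X Y = (1 / 2) * Matrix.vecMul (X : Fin n → F) (Matrix.of a.u2) ⬝ᵥ (Y : Fin n → F) := by
  simp only [theta20, dxKer, LinearMap.sum_apply, LinearMap.smul_apply, LinearMap.smulRight_apply,
    LinearMap.comp_apply, Submodule.subtype_apply, LinearMap.proj_apply, smul_eq_mul,
    Matrix.vecMul, dotProduct, Matrix.of_apply, Finset.sum_mul, Finset.mul_sum]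
  rw [Finset.sum_comm]
  exact Finset.sum_congr rfl fun i _ => Finset.sum_congr rfl fun j _ => by ring

theorem theta30_apply (Z X Y : a.kerTheta1) :
    a.theta30 Z X Y = (1 / 6) * (a.slice Z).mulVec (X : Fin n → F) ⬝ᵥ (Y : Fin n → F) := by
  simp only [theta30, dxKer, LinearMap.sum_apply, LinearMap.smul_apply, LinearMap.smulRight_apply,
    LinearMap.comp_apply, Submodule.subtype_apply, LinearMap.proj_apply, smul_eq_mul, slice,
    Matrix.mulVec, dotProduct, Matrix.of_apply, Finset.sum_mul, Finset.mul_sum]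
  rw [Finset.sum_congr rfl fun i _ => Finset.sum_comm, Finset.sum_comm]
  refine Finset.sum_congr rfl fun l _ => ?_
  rw [Finset.sum_comm]
  exact Finset.sum_congr rfl fun j _ => Finset.sum_congr rfl fun i _ => by ring

variable {a}

theorem Transversal.vecMul_x (ha : a.Transversal) :
    ∃ κ : F, Matrix.vecMul a.x (Matrix.of a.u2) = κ • a.u1 := by
  obtain ⟨κ, h⟩ := ha.euler
  exact ⟨κ, by ext j; simpa [Matrix.vecMul, dotProduct] using h j⟩

theorem Transversal.vecMul_eq (ha : a.Transversal) (X : Fin n → F) :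
    Matrix.vecMul X (Matrix.of a.u2) = (Matrix.of a.u2).mulVec X := by
  ext j
  simp only [Matrix.vecMul, Matrix.mulVec, dotProduct, Matrix.of_apply]
  exact Finset.sum_congr rfl fun i _ => by rw [ha.symm i j, mul_comm]

theorem Transversal.projInv_mulVec_mem (ha : a.Transversal) (G : Matrix (Fin n) (Fin n) F)
    (η : Fin n → F) : (a.projInv G (a.u1 ⬝ᵥ a.x)⁻¹).mulVec η ∈ a.kerTheta1 := by
  rw [mem_kerTheta1, projInv_mulVec, dotProduct_sub, dotProduct_smul, smul_eq_mul, mul_right_comm,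
    inv_mul_cancel₀ ha.radial_ne_zero, one_mul, sub_self]

/-- For a regular jet the frame is a basis, the radial vector being transversal to `ker Θ₁`. -/
theorem Transversal.det_frame_ne_zero (ha : a.Transversal) (hn : n ≠ 0)
    (hli : LinearIndependent F fun i : Fin (n - 1) => a.krylov i) : a.frame.det ≠ 0 := by
  obtain ⟨m, rfl⟩ := Nat.exists_eq_succ_of_ne_zero hn
  have hrows : a.frame.row = Fin.snoc (fun i : Fin m => a.krylov i) a.x := by
    ext i j
    refine Fin.lastCases ?_ (fun i => ?_) i
    · simp [frame, Matrix.row]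
    · have : (i : ℕ) ≠ m := i.2.ne
      simp [frame, Matrix.row, this]
  have : LinearIndependent F a.frame.row := by
    rw [hrows, linearIndependent_finSnoc]
    refine ⟨hli, fun hx => ha.radial_ne_zero ((mem_kerTheta1 a).1 ?_)⟩
    refine (Submodule.span_le (p := a.kerTheta1)).2 ?_ hx
    rintro _ ⟨i, rfl⟩
    exact Subtype.prop _
  rw [Matrix.linearIndependent_rows_iff_isUnit, Matrix.isUnit_iff_isUnit_det] at this
  exact this.ne_zero

variable [Algebra ℝ F]

theorem Transversal.nondegenerate (ha : a.Transversal) : a.theta20.Nondegenerate := by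
  have : CharZero F := charZero_of_injective_algebraMap (algebraMap ℝ F).injective
  obtain ⟨κ, hx⟩ := ha.vecMul_x
  have hL : ∀ X : a.kerTheta1, (∀ Y, a.theta20 X Y = 0) → X = 0 := by
    intro X hX
    have h0 : Matrix.vecMul (X : Fin n → F) (Matrix.of a.u2) = 0 := by
      -- The whole space is the sum of `ker Θ₁` and the radial line.
      have hr : Matrix.vecMul (X : Fin n → F) (Matrix.of a.u2) ⬝ᵥ a.x = 0 := by
        rw [← Matrix.dotProduct_mulVec, ← ha.vecMul_eq, hx, dotProduct_smul, dotProduct_comm,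
          (mem_kerTheta1 a).1 X.2, smul_zero]
      refine dotProduct_eq_zero _ fun w => ?_
      have hw : w - ((a.u1 ⬝ᵥ w) / (a.u1 ⬝ᵥ a.x)) • a.x ∈ a.kerTheta1 := by
        rw [mem_kerTheta1, dotProduct_sub, dotProduct_smul, smul_eq_mul,
          div_mul_cancel₀ _ ha.radial_ne_zero, sub_self]
      have := hX ⟨_, hw⟩
      rw [theta20_apply, dotProduct_sub, dotProduct_smul, hr, smul_zero, sub_zero] at this
      simpa using this
    exact Subtype.ext (Matrix.eq_zero_of_vecMul_eq_zero ha.det_ne_zero h0)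
  refine ⟨hL, fun Y hY => hL Y fun X => ?_⟩
  rw [theta20_apply, ha.vecMul_eq, dotProduct_comm, Matrix.dotProduct_mulVec, ← theta20_apply, hY X]

/-- The matrix `projInv` raises indices on `ker Θ₁`. -/
theorem Transversal.sharp_apply (ha : a.Transversal) (ξ : Module.Dual F a.kerTheta1) (η : Fin n → F)
    (hξ : ∀ Y : a.kerTheta1, ξ Y = η ⬝ᵥ (Y : Fin n → F)) :
    (a.sharp ξ : Fin n → F) =
      (2 : ℝ) • (a.projInv (Matrix.of a.u2)⁻¹ (a.u1 ⬝ᵥ a.x)⁻¹).mulVec η := by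
  have : CharZero F := charZero_of_injective_algebraMap (algebraMap ℝ F).injective
  obtain ⟨κ, hx⟩ := ha.vecMul_x
  have hHinv : Matrix.of a.u2 * (Matrix.of a.u2)⁻¹ = 1 :=
    Matrix.mul_nonsing_inv _ (isUnit_iff_ne_zero.2 ha.det_ne_zero)
  set G := (Matrix.of a.u2)⁻¹
  have h2 : ∀ w : Fin n → F, (2 : ℝ) • w = (2 : F) • w := fun w => by
    rw [two_smul, two_smul]
  have hP := projInv_mulVec a G (a.u1 ⬝ᵥ a.x)⁻¹ η
  have hmem : (2 : ℝ) • (a.projInv G (a.u1 ⬝ᵥ a.x)⁻¹).mulVec η ∈ a.kerTheta1 := by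
    rw [h2]
    exact Submodule.smul_mem _ _ (ha.projInv_mulVec_mem _ η)
  rw [sharp, dif_pos ha.nondegenerate]
  have : (a.theta20.toDual ha.nondegenerate).symm ξ = ⟨_, hmem⟩ := by
    rw [LinearEquiv.symm_apply_eq]
    ext Y
    rw [LinearMap.BilinForm.toDual_def, theta20_apply, hξ]
    dsimp only
    rw [h2, hP, Matrix.smul_vecMul,
      Matrix.sub_vecMul, Matrix.smul_vecMul, hx, ha.vecMul_eq, Matrix.mulVec_mulVec, hHinv,
      Matrix.one_mulVec, smul_dotProduct, sub_dotProduct, smul_dotProduct, smul_dotProduct,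
      (mem_kerTheta1 a).1 Y.2]
    simp
  exact congrArg Subtype.val this

theorem Transversal.raise_apply (ha : a.Transversal) (Z X : a.kerTheta1) :
    (a.raise Z X : Fin n → F) =
      (a.raiseMatrix (Matrix.of a.u2)⁻¹ (a.u1 ⬝ᵥ a.x)⁻¹ Z).mulVec (X : Fin n → F) := by
  have : CharZero F := charZero_of_injective_algebraMap (algebraMap ℝ F).injective
  rw [raise, LinearMap.comp_apply, ha.sharp_apply _ ((1 / 6 : F) • (a.slice Z).mulVec X) fun Y => by
    rw [theta30_apply, smul_dotProduct, smul_eq_mul]]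
  rw [raiseMatrix, Matrix.smul_mulVec, ← Matrix.mulVec_mulVec, Matrix.mulVec_smul]
  have h : (1 / 6 : F) = algebraMap ℝ F (1 / 6) := by simp [map_ofNat]
  rw [h, algebraMap_smul, smul_smul]
  norm_num

/-- An endomorphism of the whole space with values in `ker Θ₁` has the same trace as its restriction
to `ker Θ₁`, so `λ` is computed by the trace of `raiseMatrix`. -/
theorem Transversal.lam_apply (ha : a.Transversal) (Z : a.kerTheta1) :
    a.lam Z = (fun i => (a.raiseMatrix (Matrix.of a.u2)⁻¹ (a.u1 ⬝ᵥ a.x)⁻¹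
      (Pi.single i 1)).trace) ⬝ᵥ (Z : Fin n → F) := by
  set G := (Matrix.of a.u2)⁻¹
  set c := (a.u1 ⬝ᵥ a.x)⁻¹
  have hmem : ∀ X, Matrix.toLin' (a.raiseMatrix G c Z) X ∈ a.kerTheta1 := by
    intro X
    have h : Matrix.toLin' (a.raiseMatrix G c Z) X =
        algebraMap ℝ F (1 / 3) • (a.projInv G c).mulVec ((a.slice Z).mulVec X) := by
      rw [Matrix.toLin'_apply, raiseMatrix, Matrix.smul_mulVec, Matrix.mulVec_mulVec,
        algebraMap_smul]
    rw [h]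
    exact Submodule.smul_mem _ _ (ha.projInv_mulVec_mem _ _)
  have htr : a.lam Z = (a.raiseMatrix G c Z).trace := by
    rw [← Matrix.trace_toLin'_eq, ← LinearMap.trace_restrict_eq_of_forall_mem _ _ hmem]
    refine congrArg _ (LinearMap.ext fun X => Subtype.ext ?_)
    rw [ha.raise_apply]
    rfl
  have hZ : (Z : Fin n → F) = ∑ i, (Z : Fin n → F) i • Pi.single i 1 := by
    ext j; simp [Finset.sum_apply, Pi.single_apply]
  rw [htr]
  nth_rw 1 [hZ]
  rw [raiseMatrix_sum, Matrix.trace_sum]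
  simp [dotProduct, mul_comm]

theorem Transversal.lamHat_eq (ha : a.Transversal) :
    (a.lamHat : Fin n → F) = a.lamVec (Matrix.of a.u2)⁻¹ (a.u1 ⬝ᵥ a.x)⁻¹ :=
  ha.sharp_apply _ _ ha.lam_apply

theorem Transversal.krylov_eq (ha : a.Transversal) (m : ℕ) : a.krylov m =
    (a.raiseMatrix (Matrix.of a.u2)⁻¹ (a.u1 ⬝ᵥ a.x)⁻¹
      (a.lamVec (Matrix.of a.u2)⁻¹ (a.u1 ⬝ᵥ a.x)⁻¹) ^ m).mulVec
        (a.lamVec (Matrix.of a.u2)⁻¹ (a.u1 ⬝ᵥ a.x)⁻¹) := by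
  induction m with
  | zero => simp [krylov, ha.lamHat_eq]
  | succ m ih =>
    rw [pow_succ', ← Matrix.mulVec_mulVec, ← ih, krylov, pow_succ', Module.End.mul_apply, Phi,
      ha.raise_apply, ha.lamHat_eq]
    rfl

theorem Transversal.frame_eq (ha : a.Transversal) :
    a.frame = a.ringFrame (Matrix.of a.u2)⁻¹ (a.u1 ⬝ᵥ a.x)⁻¹ := by
  ext i j
  rw [frame, ringFrame, Matrix.of_apply, Matrix.of_apply, ha.krylov_eq]

end Field

end Jet3

/-! ### The group action on jets -/

namespace Jet3

theorem ext_fields {F : Type} {a b : Jet3 n F} (hx : a.x = b.x) (hu : a.u = b.u) (h1 : a.u1 = b.u1)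
    (h2 : a.u2 = b.u2) (h3 : a.u3 = b.u3) : a = b := by
  cases a; cases b; simp_all

theorem map_pull {R R' : Type} [CommRing R] [CommRing R'] (f : R →+* R')
    (B Binv : Matrix (Fin n) (Fin n) R) (a : Jet3 n R) :
    (a.pull B Binv).map f = (a.map f).pull (B.map f) (Binv.map f) := by
  refine ext_fields ?_ rfl ?_ ?_ ?_
  · ext i; simp [pull, map, Matrix.mulVec, dotProduct]
  · ext i; simp [pull, map]
  · ext i j; simp [pull, map]
  · ext i j l; simp [pull, map]

theorem act_eq_pull (A : GL (Fin n) ℝ) (a : Jet3 n ℝ) : a.act A = a.pull (A⁻¹).val A.val := rfl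

/-- The slices in the coordinate directions are the entries of third order. -/
theorem u3_eq_slice {R : Type} [CommRing R] (a : Jet3 n R) (i j l : Fin n) :
    a.u3 i j l = a.slice (Pi.single i 1) l j := by
  simp [slice, Pi.single_apply]

theorem act_mul (A B : GL (Fin n) ℝ) (a : Jet3 n ℝ) : (a.act A).act B = a.act (B * A) := by
  have hA : (A⁻¹).val * A.val = 1 := by rw [← Units.val_mul, inv_mul_cancel, Units.val_one]
  have hA' : A.val * (A⁻¹).val = 1 := by rw [← Units.val_mul, mul_inv_cancel, Units.val_one]
  have hB : (B⁻¹).val * B.val = 1 := by rw [← Units.val_mul, inv_mul_cancel, Units.val_one]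
  have hB' : B.val * (B⁻¹).val = 1 := by rw [← Units.val_mul, mul_inv_cancel, Units.val_one]
  have hBA : ((B * A)⁻¹).val * (B * A).val = 1 := by
    rw [← Units.val_mul, inv_mul_cancel, Units.val_one]
  have hinv : ((B * A)⁻¹).val = (A⁻¹).val * (B⁻¹).val := by rw [mul_inv_rev, Units.val_mul]
  simp only [act_eq_pull]
  refine ext_fields ?_ rfl ?_ ?_ ?_
  · simp [pull, Matrix.mulVec_mulVec]
  · rw [pull_u1, pull_u1, pull_u1, Matrix.vecMul_vecMul, hinv]
  · refine (Matrix.of : (Fin n → Fin n → ℝ) ≃ _).injective ?_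
    rw [pull_hess, pull_hess, pull_hess, hinv, Matrix.transpose_mul]
    simp only [mul_assoc]
  · have key : ∀ W, ((a.pull (A⁻¹).val A.val).pull (B⁻¹).val B.val).slice W =
        (a.pull ((B * A)⁻¹).val (B * A).val).slice W := by
      intro W
      have hW : W = B.val.mulVec (A.val.mulVec (((B * A)⁻¹).val.mulVec W)) := by
        rw [hinv, Matrix.mulVec_mulVec, Matrix.mulVec_mulVec, mul_assoc, ← mul_assoc A.val, hA',
          one_mul, hB', Matrix.one_mulVec]
      rw [hW, pull_slice _ hB, pull_slice _ hA, Matrix.mulVec_mulVec, ← Units.val_mul,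
        pull_slice _ hBA, hinv, Matrix.transpose_mul]
      simp only [mul_assoc]
    ext i j l
    rw [u3_eq_slice, key, ← u3_eq_slice]

theorem act_mem_Euler3 {k : ℕ} (A : GL (Fin n) ℝ) {a : Jet3 n ℝ} (ha : a ∈ Euler3 n k) :
    a.act A ∈ Euler3 n k := by
  obtain ⟨hx, h2, h3, e1, e2, e3⟩ := ha
  have hA : (A⁻¹).val * A.val = 1 := by rw [← Units.val_mul, inv_mul_cancel, Units.val_one]
  have hH : (Matrix.of a.u2).transpose = Matrix.of a.u2 := by ext i j; exact h2 j i
  have e2' : Matrix.vecMul a.x (Matrix.of a.u2) = ((k : ℝ) - 1) • a.u1 := by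
    ext j; simpa [Matrix.vecMul, dotProduct] using e2 j
  have e3' : a.slice a.x = ((k : ℝ) - 2) • Matrix.of a.u2 := by
    ext l j; simpa [slice, h2 l j] using e3 j l
  rw [act_eq_pull]
  refine ⟨?_, ?_, ?_, ?_, ?_, ?_⟩
  · intro h0
    refine hx ?_
    have : (A⁻¹).val.mulVec (A.val.mulVec a.x) = 0 := by
      change A.val.mulVec a.x = 0 at h0
      rw [h0, Matrix.mulVec_zero]
    rwa [Matrix.mulVec_mulVec, hA, Matrix.one_mulVec] at this
  · intro i j
    have : (Matrix.of (a.pull (A⁻¹).val A.val).u2).transpose =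
        Matrix.of (a.pull (A⁻¹).val A.val).u2 := by
      rw [pull_hess, Matrix.transpose_mul, Matrix.transpose_mul, hH, Matrix.transpose_transpose,
        mul_assoc]
    exact (congrFun (congrFun this i) j).symm
  · intro i j l
    simp only [pull]
    constructor
    · rw [Finset.sum_comm]
      refine Finset.sum_congr rfl fun q _ => Finset.sum_congr rfl fun p _ =>
        Finset.sum_congr rfl fun r _ => ?_
      rw [(h3 p q r).1]; ring
    · refine Finset.sum_congr rfl fun p _ => ?_
      rw [Finset.sum_comm]
      refine Finset.sum_congr rfl fun q _ => Finset.sum_congr rfl fun r _ => ?_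
      rw [(h3 p q r).2]; ring
  · change (A.val.mulVec a.x) ⬝ᵥ (a.pull (A⁻¹).val A.val).u1 = (k : ℝ) * a.u
    rw [pull_u1, dotProduct_comm, ← Matrix.dotProduct_mulVec, Matrix.mulVec_mulVec, hA,
      Matrix.one_mulVec, dotProduct_comm]
    exact e1
  · intro j
    have : Matrix.vecMul (A.val.mulVec a.x) (Matrix.of (a.pull (A⁻¹).val A.val).u2) =
        ((k : ℝ) - 1) • (a.pull (A⁻¹).val A.val).u1 := by
      rw [pull_hess, pull_u1, ← Matrix.smul_vecMul, ← e2', ← Matrix.vecMul_vecMul,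
        ← Matrix.vecMul_vecMul, Matrix.vecMul_transpose, Matrix.mulVec_mulVec, hA,
        Matrix.one_mulVec]
    exact congrFun this j
  · intro j l
    have : (a.pull (A⁻¹).val A.val).slice (A.val.mulVec a.x) =
        ((k : ℝ) - 2) • (Matrix.of (a.pull (A⁻¹).val A.val).u2).transpose := by
      rw [pull_slice a hA, pull_hess, e3', Matrix.transpose_mul, Matrix.transpose_mul, hH,
        Matrix.transpose_transpose, Matrix.mul_smul, Matrix.smul_mul, mul_assoc]
    exact congrFun (congrFun this l) j

end Jet3

/-! ### Jets of forms -/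

/-- The 3-jet of `h` with polynomial entries. -/
abbrev jetPoly (h : MvPolynomial (Fin n) ℝ) : Jet3 n (MvPolynomial (Fin n) ℝ) :=
  jetOf (RingHom.id _) h

theorem jetOf_eq_map {F : Type} [CommRing F] (φ : MvPolynomial (Fin n) ℝ →+* F)
    (h : MvPolynomial (Fin n) ℝ) : jetOf φ h = (jetPoly h).map φ := rfl

theorem pderiv_comm (i j : Fin n) (p : MvPolynomial (Fin n) ℝ) :
    pderiv i (pderiv j p) = pderiv j (pderiv i p) := by
  classical
  let D : Fin n → Derivation ℝ (MvPolynomial (Fin n) ℝ) (MvPolynomial (Fin n) ℝ) :=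
    fun l => pderiv l
  have h0 : ⁅D i, D j⁆ = 0 := by
    refine derivation_ext fun l => ?_
    simp [D, Derivation.commutator_apply, pderiv_X, Pi.single_apply, apply_ite]
  have := congrArg (fun d : Derivation ℝ _ (MvPolynomial (Fin n) ℝ) => d p) h0
  simpa [D, Derivation.commutator_apply, sub_eq_zero] using this

section Euler

variable {k : ℕ} {h : MvPolynomial (Fin n) ℝ} {F : Type} [CommRing F]
  (φ : MvPolynomial (Fin n) ℝ →+* F)

theorem euler_one (hh : h.IsHomogeneous k) :
    ∑ i, (jetOf φ h).x i * (jetOf φ h).u1 i = (k : F) * (jetOf φ h).u := by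
  have := congrArg φ hh.sum_X_mul_pderiv
  simpa [jetOf] using this

theorem euler_two (hk : 1 ≤ k) (hh : h.IsHomogeneous k) (j : Fin n) :
    ∑ i, (jetOf φ h).x i * (jetOf φ h).u2 i j = ((k : F) - 1) * (jetOf φ h).u1 j := by
  have := congrArg φ (hh.pderiv (i := j)).sum_X_mul_pderiv
  simpa [jetOf, Nat.cast_sub hk] using this

theorem euler_three (hk : 2 ≤ k) (hh : h.IsHomogeneous k) (j l : Fin n) :
    ∑ i, (jetOf φ h).x i * (jetOf φ h).u3 i j l = ((k : F) - 2) * (jetOf φ h).u2 j l := by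
  have := congrArg φ ((hh.pderiv (i := l)).pderiv (i := j)).sum_X_mul_pderiv
  have hc : ((k - 1 - 1 : ℕ) : F) = (k : F) - 2 := by
    rw [Nat.sub_sub, Nat.cast_sub (by omega)]; norm_num
  simpa [jetOf, hc] using this

theorem jetAt_mem_Euler3 (hk : 2 ≤ k) (hh : h.IsHomogeneous k) {v : Fin n → ℝ} (hv : v ≠ 0) :
    jetAt h v ∈ Euler3 n k := by
  refine ⟨?_, ?_, ?_, euler_one _ hh, euler_two _ (by omega) hh, euler_three _ hk hh⟩
  · intro h0
    exact hv (by simpa [jetOf] using h0)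
  · intro i j
    simp [jetOf, pderiv_comm i j]
  · intro i j l
    exact ⟨by simp [jetOf, pderiv_comm i j], by simp [jetOf, pderiv_comm j l]⟩

end Euler

theorem transversal_jetOf {k : ℕ} (hk : 2 ≤ k) {h : MvPolynomial (Fin n) ℝ}
    (hh : h.IsHomogeneous k) {F : Type} [Field F] [CharZero F] (φ : MvPolynomial (Fin n) ℝ →+* F)
    (hu : φ h ≠ 0) (hdet : (Matrix.of (jetOf φ h).u2).det ≠ 0) : (jetOf φ h).Transversal where
  symm i j := by simp [jetOf, pderiv_comm i j]
  det_ne_zero := hdet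
  radial_ne_zero := by
    have := euler_one φ hh
    rw [dotProduct_comm, dotProduct, this]
    exact mul_ne_zero (by norm_cast; omega) hu
  euler := ⟨_, euler_two φ (by omega) hh⟩

theorem det_hess_jetOf {F : Type} [CommRing F] (φ : MvPolynomial (Fin n) ℝ →+* F)
    (h : MvPolynomial (Fin n) ℝ) :
    (Matrix.of (jetOf φ h).u2).det = φ (Matrix.of (jetPoly h).u2).det := by
  rw [RingHom.map_det]; rfl

/-- The frame of a form with a regular 3-jet is a basis over the field of rational functions: it
specializes, over the local ring at the regular point, to the frame of that jet. -/
theorem det_frameOf_ne_zero (hn : n ≠ 0) {k : ℕ} (hk : 2 ≤ k) {h : MvPolynomial (Fin n) ℝ}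
    (hh : h.IsHomogeneous k) {v : Fin n → ℝ} (hv : (jetAt h v).Regular) :
    (frameOf h).det ≠ 0 ∧ (jetVar h).Transversal := by
  obtain ⟨hu, hdet, hli⟩ := hv
  have hdet' := hdet
  rw [det_hess_jetOf] at hdet'
  have hTv : (jetAt h v).Transversal := transversal_jetOf hk hh _ hu hdet
  have : CharZero (RatFn n) := charZero_of_injective_algebraMap (algebraMap ℝ _).injective
  have hT : (jetVar h).Transversal := by
    refine transversal_jetOf hk hh _ (RatFn.algebraMap_ne_zero ?_) ?_
    · rintro rfl; simp [jetOf] at hu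
    · rw [det_hess_jetOf]
      refine RatFn.algebraMap_ne_zero fun h0 => hdet' ?_
      rw [h0, map_zero]
  refine ⟨?_, hT⟩
  let a : Jet3 n (RatFn.valueSubalgebra v) :=
    (jetPoly h).map fun p => (RatFn.hasValue_algebraMap (v := v) p).lift
  have ha : a.map (RatFn.toRatFn v) = jetVar h := rfl
  have ha' : a.map (RatFn.toReal v) = jetAt h v := rfl
  have hH : IsUnit (Matrix.of a.u2).det := by
    refine RatFn.isUnit_of_toReal_ne_zero ?_
    have : RatFn.toReal v (Matrix.of a.u2).det = (Matrix.of (jetAt h v).u2).det := by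
      rw [AlgHom.map_det]; rfl
    rwa [this]
  have hc : IsUnit (a.u1 ⬝ᵥ a.x) := by
    refine RatFn.isUnit_of_toReal_ne_zero ?_
    have : RatFn.toReal v (a.u1 ⬝ᵥ a.x) = (jetAt h v).u1 ⬝ᵥ (jetAt h v).x := by
      simp only [dotProduct, map_sum, map_mul]; rfl
    rw [this]
    exact hTv.radial_ne_zero
  have key : ∀ {K : Type} [Field K] [Algebra ℝ K] (f : RatFn.valueSubalgebra v →ₐ[ℝ] K),
      (a.map f).Transversal →
      (a.map f).frame.det = f (a.ringFrame (Matrix.of a.u2)⁻¹ (Ring.inverse (a.u1 ⬝ᵥ a.x))).det := by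
    intro K _ _ f hf
    rw [hf.frame_eq, AlgHom.map_det]
    have h1 : (Matrix.of (a.map f).u2)⁻¹ = (Matrix.of a.u2)⁻¹.map f := by
      refine Matrix.inv_eq_right_inv ?_
      have := congrArg (RingHom.mapMatrix (f : _ →+* K)) (Matrix.mul_nonsing_inv _ hH)
      rw [map_mul, map_one] at this
      exact this
    have h2 : ((a.map f).u1 ⬝ᵥ (a.map f).x)⁻¹ = f (Ring.inverse (a.u1 ⬝ᵥ a.x)) := by
      have h3 : (a.map f).u1 ⬝ᵥ (a.map f).x = f (a.u1 ⬝ᵥ a.x) := by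
        simp only [dotProduct, map_sum, map_mul]; rfl
      rw [h3]
      refine inv_eq_of_mul_eq_one_right ?_
      rw [← map_mul, Ring.mul_inverse_cancel _ hc, map_one]
    rw [h1, h2, ← Jet3.map_ringFrame]
    rfl
  have hv0 := hTv.det_frame_ne_zero hn hli
  rw [← ha', key _ (ha' ▸ hTv)] at hv0
  rw [frameOf, ← ha, key _ (ha ▸ hT)]
  exact ((RatFn.isUnit_of_toReal_ne_zero hv0).map _).ne_zero

/-! ### Equivalent forms have the same image -/

theorem linSub_linSub (A B : Matrix (Fin n) (Fin n) ℝ) (p : MvPolynomial (Fin n) ℝ) :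
    linSub A (linSub B p) = linSub (B * A) p :=
  MvPolynomial.funext fun v => by simp [eval_linSub, Matrix.mulVec_mulVec]

theorem linSub_one (p : MvPolynomial (Fin n) ℝ) : linSub 1 p = p :=
  MvPolynomial.funext fun v => by simp [eval_linSub]

theorem linSub_inv_linSub (A : GL (Fin n) ℝ) (p : MvPolynomial (Fin n) ℝ) :
    linSub (A⁻¹).val (linSub A.val p) = p := by
  rw [linSub_linSub, ← Units.val_mul, mul_inv_cancel, Units.val_one, linSub_one]

theorem equivalent_iff {h h' : MvPolynomial (Fin n) ℝ} :
    Equivalent h h' ↔ ∃ A : GL (Fin n) ℝ, h' = linSub A.val h := by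
  refine exists_congr fun A => ⟨fun hA => MvPolynomial.funext fun v => ?_, fun hA v => ?_⟩
  · rw [hA, eval_linSub]
  · rw [hA, eval_linSub]

theorem Equivalent.symm {h h' : MvPolynomial (Fin n) ℝ} (e : Equivalent h h') :
    Equivalent h' h := by
  obtain ⟨A, rfl⟩ := equivalent_iff.1 e
  exact equivalent_iff.2 ⟨A⁻¹, (linSub_inv_linSub A h).symm⟩

theorem jetPoly_linSub (A : GL (Fin n) ℝ) (h : MvPolynomial (Fin n) ℝ) :
    jetPoly (linSub A.val h) =
      ((jetPoly h).map (linSub A.val)).pull (A.val.map C) ((A⁻¹).val.map C) := by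
  refine Jet3.ext_fields ?_ rfl ?_ ?_ ?_
  · have hX : ((jetPoly h).map (linSub A.val)).x =
        (A.val.map C).mulVec (X : Fin n → MvPolynomial (Fin n) ℝ) := by
      ext1 i
      simp [Jet3.map, jetOf, Matrix.mulVec, dotProduct]
    have hA : (A⁻¹).val.map C * A.val.map C =
        (1 : Matrix (Fin n) (Fin n) (MvPolynomial (Fin n) ℝ)) := by
      rw [← Matrix.map_mul, ← Units.val_mul, inv_mul_cancel, Units.val_one]
      exact Matrix.map_one _ (map_zero _) (map_one _)
    simp only [Jet3.pull]
    rw [hX, Matrix.mulVec_mulVec, hA, Matrix.one_mulVec]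
    rfl
  · ext1 i
    simp only [jetOf, Jet3.pull, Jet3.map, RingHom.id_apply, pderiv_linSub, Matrix.map_apply,
      mul_comm]
  · ext1 i; ext1 j
    simp only [jetOf, Jet3.pull, Jet3.map, RingHom.id_apply, pderiv_linSub, Matrix.map_apply,
      map_sum, pderiv_C_mul, Finset.mul_sum]
    rw [Finset.sum_comm]
    exact Finset.sum_congr rfl fun p _ => Finset.sum_congr rfl fun q _ => by ring
  · ext1 i; ext1 j; ext1 l
    simp only [jetOf, Jet3.pull, Jet3.map, RingHom.id_apply, pderiv_linSub, Matrix.map_apply,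
      map_sum, pderiv_C_mul, Finset.mul_sum]
    rw [Finset.sum_congr rfl fun r _ => Finset.sum_comm, Finset.sum_comm]
    refine Finset.sum_congr rfl fun p _ => ?_
    rw [Finset.sum_comm]
    exact Finset.sum_congr rfl fun q _ => Finset.sum_congr rfl fun r _ => by ring

theorem jetAt_linSub (A : GL (Fin n) ℝ) (h : MvPolynomial (Fin n) ℝ) (v : Fin n → ℝ) :
    jetAt (linSub A.val h) v = (jetAt h (A.val.mulVec v)).pull A.val (A⁻¹).val := by
  have ha : ((jetPoly h).map (linSub A.val)).map (eval v) = jetAt h (A.val.mulVec v) :=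
    Jet3.ext_fields (by ext; simp [Jet3.map, jetOf, Matrix.mulVec, dotProduct])
      (by simp [Jet3.map, eval_linSub, jetOf]) (by ext; simp [Jet3.map, eval_linSub, jetOf])
      (by ext; simp [Jet3.map, eval_linSub, jetOf]) (by ext; simp [Jet3.map, eval_linSub, jetOf])
  have hC : ∀ B : Matrix (Fin n) (Fin n) ℝ, (B.map C).map (eval v) = B := fun B => by ext; simp
  rw [jetAt, jetOf_eq_map, jetPoly_linSub, Jet3.map_pull, ha, hC, hC]

theorem act_jetAt_linSub (A : GL (Fin n) ℝ) (h : MvPolynomial (Fin n) ℝ) (v : Fin n → ℝ) :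
    (jetAt (linSub A.val h) v).act A = jetAt h (A.val.mulVec v) := by
  have := jetAt_linSub A⁻¹ (linSub A.val h) (A.val.mulVec v)
  rw [linSub_inv_linSub, Matrix.mulVec_mulVec, ← Units.val_mul, inv_mul_cancel, Units.val_one,
    Matrix.one_mulVec, inv_inv] at this
  exact this.symm

/-- The matrix `A` with entries regarded as constant rational functions. -/
def constMatrix (A : Matrix (Fin n) (Fin n) ℝ) : Matrix (Fin n) (Fin n) (RatFn n) :=
  A.map (algebraMap ℝ (RatFn n))

theorem constMatrix_mul (A B : Matrix (Fin n) (Fin n) ℝ) :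
    constMatrix A * constMatrix B = constMatrix (A * B) :=
  (map_mul (RingHom.mapMatrix (algebraMap ℝ (RatFn n))) A B).symm

theorem constMatrix_mul_inv (A : GL (Fin n) ℝ) :
    constMatrix A.val * constMatrix (A⁻¹).val = 1 := by
  rw [constMatrix_mul, ← Units.val_mul, mul_inv_cancel, Units.val_one]
  exact map_one (RingHom.mapMatrix (algebraMap ℝ (RatFn n)))

theorem jetVar_linSub (A : GL (Fin n) ℝ) (h : MvPolynomial (Fin n) ℝ) :
    jetVar (linSub A.val h) =
      ((jetVar h).map (ratSub A)).pull (constMatrix A.val) (constMatrix (A⁻¹).val) := by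
  have ha : ((jetPoly h).map (linSub A.val)).map (algebraMap _ (RatFn n)) =
      (jetVar h).map (ratSub A) :=
    Jet3.ext_fields (by ext; simp [Jet3.map, jetOf])
      (by simp [Jet3.map, jetOf]) (by ext; simp [Jet3.map, jetOf])
      (by ext; simp [Jet3.map, jetOf]) (by ext; simp [Jet3.map, jetOf])
  have hC : ∀ B : Matrix (Fin n) (Fin n) ℝ, (B.map C).map
      (algebraMap (MvPolynomial (Fin n) ℝ) (RatFn n)) =
      constMatrix B := fun B => by ext; simp [constMatrix, RatFn.algebraMap_real]
  rw [jetVar, jetOf_eq_map, jetPoly_linSub, Jet3.map_pull, ha, hC, hC]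

/-- The restriction of a polynomial in the jet coordinates to the jets of `h`. -/
def along (h : MvPolynomial (Fin n) ℝ) (P : MvPolynomial (Coord n) ℝ) : MvPolynomial (Fin n) ℝ :=
  aeval (jetPoly h).coord P

theorem Jet3.coord_map {F F' : Type} (f : F → F') (a : Jet3 n F) (c : Coord n) :
    (a.map f).coord c = f (a.coord c) := by cases c <;> rfl

theorem aeval_jetVar (h : MvPolynomial (Fin n) ℝ) (P : MvPolynomial (Coord n) ℝ) :
    aeval (jetVar h).coord P = algebraMap _ (RatFn n) (along h P) := by
  rw [along, ← IsScalarTower.coe_toAlgHom' ℝ, ← AlgHom.comp_apply, comp_aeval]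
  congr 2
  ext c
  exact Jet3.coord_map _ (jetPoly h) c

theorem eval_along (h : MvPolynomial (Fin n) ℝ) (P : MvPolynomial (Coord n) ℝ) (v : Fin n → ℝ) :
    eval v (along h P) = eval (jetAt h v).coord P := by
  rw [along, ← coe_aeval_eq_eval, ← coe_aeval_eq_eval, RingHom.coe_coe, RingHom.coe_coe,
    ← AlgHom.comp_apply, comp_aeval]
  congr 2
  ext c
  rw [jetAt, jetOf_eq_map, Jet3.coord_map]
  simp

theorem value_eq (I : JetFraction n) (h : MvPolynomial (Fin n) ℝ) :
    I.value h = algebraMap _ (RatFn n) (along h I.num) / algebraMap _ (RatFn n) (along h I.den) := by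
  rw [JetFraction.value, aeval_jetVar, aeval_jetVar]

/-- Polynomials that agree away from the origin are equal. -/
theorem eq_of_eval_eq (hn : n ≠ 0) {p q : MvPolynomial (Fin n) ℝ}
    (hpq : ∀ v, v ≠ 0 → eval v p = eval v q) : p = q := by
  have : (p - q) * X (⟨0, Nat.pos_of_ne_zero hn⟩ : Fin n) = 0 := by
    refine MvPolynomial.funext fun v => ?_
    rcases eq_or_ne v 0 with rfl | hv
    · simp
    · simp [hpq v hv]
  exact sub_eq_zero.1 ((mul_eq_zero.1 this).resolve_right (X_ne_zero _))

theorem JetFraction.IsInvariant.cross_linSub {k : ℕ} (hn : n ≠ 0) (hk : 2 ≤ k) {I : JetFraction n}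
    (hI : I.IsInvariant k) {h : MvPolynomial (Fin n) ℝ} {A : GL (Fin n) ℝ}
    (hh : (linSub A.val h).IsHomogeneous k) :
    linSub A.val (along h I.num) * along (linSub A.val h) I.den =
      along (linSub A.val h) I.num * linSub A.val (along h I.den) := by
  refine eq_of_eval_eq hn fun v hv => ?_
  have := hI.2 A _ (jetAt_mem_Euler3 hk hh hv)
  rw [act_jetAt_linSub] at this
  simpa [eval_linSub, eval_along] using this

theorem value_linSub {k : ℕ} (hn : n ≠ 0) (hk : 2 ≤ k) {I : JetFraction n}
    (hI : I.IsInvariant k) {h : MvPolynomial (Fin n) ℝ} {A : GL (Fin n) ℝ}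
    (hh : (linSub A.val h).IsHomogeneous k) (h1 : along h I.den ≠ 0)
    (h2 : along (linSub A.val h) I.den ≠ 0) :
    I.value (linSub A.val h) = ratSub A (I.value h) := by
  have h1' : linSub A.val (along h I.den) ≠ 0 := fun h0 => h1 (linSub_injective A (by simpa using h0))
  rw [value_eq, value_eq, map_div₀, ratSub_algebraMap, ratSub_algebraMap,
    div_eq_div_iff (RatFn.algebraMap_ne_zero h2) (RatFn.algebraMap_ne_zero h1'), ← map_mul,
    ← map_mul, hI.cross_linSub hn hk hh]

theorem map_nonsing_inv {K L : Type*} [Field K] [Field L] (f : K →+* L)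
    {H : Matrix (Fin n) (Fin n) K} (hH : H.det ≠ 0) : (H.map f)⁻¹ = H⁻¹.map f := by
  refine Matrix.inv_eq_right_inv ?_
  have := congrArg (RingHom.mapMatrix f) (Matrix.mul_nonsing_inv _ (isUnit_iff_ne_zero.2 hH))
  rwa [map_mul, map_one] at this

theorem frameOf_linSub {h : MvPolynomial (Fin n) ℝ} {A : GL (Fin n) ℝ}
    (hT : (jetVar h).Transversal) (hT' : (jetVar (linSub A.val h)).Transversal) :
    frameOf (linSub A.val h) =
      (frameOf h).map (ratSub A) * (constMatrix (A⁻¹).val).transpose := by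
  have hB := constMatrix_mul_inv A
  rw [frameOf, hT'.frame_eq, frameOf, hT.frame_eq, Jet3.map_ringFrame, ← Jet3.pull_ringFrame _ _ _ hB,
    jetVar_linSub]
  have h1 : (Matrix.of (((jetVar h).map (ratSub A)).pull (constMatrix A.val)
        (constMatrix (A⁻¹).val)).u2)⁻¹ =
      constMatrix (A⁻¹).val * (Matrix.of (jetVar h).u2)⁻¹.map (ratSub A) *
        (constMatrix (A⁻¹).val).transpose := by
    have hB' : (constMatrix A.val)⁻¹ = constMatrix (A⁻¹).val := Matrix.inv_eq_right_inv hB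
    have hm : Matrix.of ((jetVar h).map (ratSub A)).u2 =
        (Matrix.of (jetVar h).u2).map (ratSub A : RatFn n →+* RatFn n) := rfl
    rw [Jet3.pull_hess, Matrix.mul_inv_rev, Matrix.mul_inv_rev, ← Matrix.transpose_nonsing_inv, hB',
      hm, map_nonsing_inv _ hT.det_ne_zero, mul_assoc]
    rfl
  have h2 : (((jetVar h).map (ratSub A)).pull (constMatrix A.val) (constMatrix (A⁻¹).val)).u1 ⬝ᵥ
      (((jetVar h).map (ratSub A)).pull (constMatrix A.val) (constMatrix (A⁻¹).val)).x =
      ratSub A ((jetVar h).u1 ⬝ᵥ (jetVar h).x) := by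
    rw [Jet3.pull_u1, ← Matrix.dotProduct_mulVec]
    simp only [Jet3.pull]
    rw [Matrix.mulVec_mulVec, hB, Matrix.one_mulVec]
    simp [dotProduct, Jet3.map]
  rw [h1, h2, map_inv₀]

theorem frameDeriv_linSub {h : MvPolynomial (Fin n) ℝ} {A : GL (Fin n) ℝ}
    (hT : (jetVar h).Transversal) (hT' : (jetVar (linSub A.val h)).Transversal) (a : Fin n)
    (f : RatFn n) :
    frameDeriv (linSub A.val h) a (ratSub A f) = ratSub A (frameDeriv h a f) := by
  have hrow : frameOf (linSub A.val h) a = Matrix.vecMul (fun i => ratSub A (frameOf h a i))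
      (constMatrix (A⁻¹).val).transpose := by
    rw [frameOf_linSub hT hT']; ext i; simp [Matrix.mul_apply, Matrix.vecMul, dotProduct]
  have hd : (fun i => RatFn.pderiv i (ratSub A f)) =
      (constMatrix A.val).transpose.mulVec fun j => ratSub A (RatFn.pderiv j f) := by
    ext i; simp [pderiv_ratSub, Matrix.mulVec, dotProduct, constMatrix]
  change frameOf (linSub A.val h) a ⬝ᵥ (fun i => RatFn.pderiv i (ratSub A f)) = _
  rw [hrow, hd, ← Matrix.dotProduct_mulVec, Matrix.mulVec_mulVec, ← Matrix.transpose_mul,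
    constMatrix_mul_inv, Matrix.transpose_one, Matrix.one_mulVec]
  simp [frameDeriv, dotProduct]

/-- The derivative along a vector of the frame, as a derivation. -/
def frameDerivation (h : MvPolynomial (Fin n) ℝ) (a : Fin n) :
    Derivation ℝ (RatFn n) (RatFn n) :=
  ∑ i, frameOf h a i • RatFn.derivation i

@[simp] theorem frameDerivation_apply (h : MvPolynomial (Fin n) ℝ) (a : Fin n) (f : RatFn n) :
    frameDerivation h a f = frameDeriv h a f := by
  rw [frameDerivation, ← Derivation.coeFnAddMonoidHom_apply, map_sum, Finset.sum_apply]
  rfl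

theorem frameCoeff_linSub {k : ℕ} (hn : n ≠ 0) (hk : 2 ≤ k) {I : Fin n → JetFraction n}
    (hI : ∀ i, (I i).IsInvariant k) {h : MvPolynomial (Fin n) ℝ} {A : GL (Fin n) ℝ}
    (hh : (linSub A.val h).IsHomogeneous k) (h1 : ∀ i, along h (I i).den ≠ 0)
    (h2 : ∀ i, along (linSub A.val h) (I i).den ≠ 0)
    (hT : (jetVar h).Transversal) (hT' : (jetVar (linSub A.val h)).Transversal) (a b : Fin n) :
    frameCoeff I (linSub A.val h) a b = ratSub A (frameCoeff I h a b) := by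
  rw [frameCoeff, value_linSub hn hk (hI b) hh (h1 b) (h2 b), frameDeriv_linSub hT hT', frameCoeff]

theorem christoffel_linSub {h : MvPolynomial (Fin n) ℝ} {A : GL (Fin n) ℝ}
    (hdet : (frameOf h).det ≠ 0)
    (hT : (jetVar h).Transversal) (hT' : (jetVar (linSub A.val h)).Transversal) (a b c : Fin n) :
    christoffel (linSub A.val h) a b c = ratSub A (christoffel h a b c) := by
  have hrow : (fun i => frameDeriv (linSub A.val h) a (frameOf (linSub A.val h) b i)) =
      Matrix.vecMul (fun i => ratSub A (frameDeriv h a (frameOf h b i)))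
        (constMatrix (A⁻¹).val).transpose := by
    ext i
    have : frameOf (linSub A.val h) b i =
        ratSub A (∑ j, (A⁻¹).val i j • frameOf h b j) := by
      rw [frameOf_linSub hT hT']
      simp [Matrix.mul_apply, constMatrix, Algebra.smul_def, mul_comm]
    rw [this, frameDeriv_linSub hT hT', ← frameDerivation_apply, map_sum]
    simp [Matrix.vecMul, dotProduct, constMatrix, Algebra.smul_def, mul_comm]
  have hB : (constMatrix (A⁻¹).val).transpose * ((constMatrix (A⁻¹).val).transpose)⁻¹ = 1 := by
    have := congrArg Matrix.transpose (constMatrix_mul_inv A)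
    rw [Matrix.transpose_mul, Matrix.transpose_one] at this
    rw [Matrix.inv_eq_right_inv this, this]
  have hm : (frameOf h).map (ratSub A) = (frameOf h).map (ratSub A : RatFn n →+* RatFn n) := rfl
  rw [christoffel, hrow, frameOf_linSub hT hT', Matrix.mul_inv_rev, Matrix.vecMul_vecMul, ← mul_assoc,
    hB, one_mul, hm, map_nonsing_inv _ hdet]
  simp [christoffel, Matrix.vecMul, dotProduct]

theorem piImage_subset_of_equivalent {k : ℕ} (hn : n ≠ 0) (hk : 2 ≤ k) {I : Fin n → JetFraction n}
    (hI : ∀ i, (I i).IsInvariant k) {h : MvPolynomial (Fin n) ℝ} {A : GL (Fin n) ℝ}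
    (hh : (linSub A.val h).IsHomogeneous k) (h1 : ∀ i, along h (I i).den ≠ 0)
    (h2 : ∀ i, along (linSub A.val h) (I i).den ≠ 0) (hdet : (frameOf h).det ≠ 0)
    (hT : (jetVar h).Transversal) (hT' : (jetVar (linSub A.val h)).Transversal) :
    piImage I h ⊆ piImage I (linSub A.val h) := by
  rintro p ⟨v, hJ, hU, hΓ⟩
  have hv : A.val.mulVec ((A⁻¹).val.mulVec v) = v := by
    rw [Matrix.mulVec_mulVec, ← Units.val_mul, mul_inv_cancel, Units.val_one, Matrix.one_mulVec]
  rw [← hv] at hJ hU hΓ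
  refine ⟨(A⁻¹).val.mulVec v, fun i => ?_, fun a b => ?_, fun a b c => ?_⟩
  · rw [value_linSub hn hk (hI i) hh (h1 i) (h2 i)]
    exact (hJ i).ratSub
  · rw [frameCoeff_linSub hn hk hI hh h1 h2 hT hT']
    exact (hU a b).ratSub
  · rw [christoffel_linSub hdet hT hT']
    exact (hΓ a b c).ratSub

/-! ### Algebraic dependence of rational functions -/

theorem totalDegree_pderiv_lt {σ : Type*} {i : σ} {p : MvPolynomial σ ℝ} (hp : pderiv i p ≠ 0) :
    (pderiv i p).totalDegree < p.totalDegree := by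
  have h : ∀ m ∈ (pderiv i p).support, (m.sum fun _ e => e) < p.totalDegree := by
    intro m hm
    rw [mem_support_iff, coeff_pderiv] at hm
    have hle := le_totalDegree (mem_support_iff.2 (left_ne_zero_of_mul hm))
    rw [Finsupp.sum_add_index' (fun _ => rfl) (fun _ _ _ => rfl), Finsupp.sum_single_index rfl] at hle
    omega
  obtain ⟨m, hm⟩ := support_nonempty.2 hp
  exact (Finset.sup_lt_iff (lt_of_le_of_lt (Nat.zero_le _) (h m hm))).2 h

theorem eq_C_of_pderiv_eq_zero {σ : Type*} {p : MvPolynomial σ ℝ} (hp : ∀ i, pderiv i p = 0) :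
    p = C (coeff 0 p) := by
  classical
  ext m
  rw [coeff_C]
  split_ifs with h0
  · rw [h0]
  · obtain ⟨i, hi⟩ := Finsupp.support_nonempty_iff.2 (Ne.symm h0)
    have hm : m - Finsupp.single i 1 + Finsupp.single i 1 = m :=
      tsub_add_cancel_of_le (Finsupp.single_le_iff.2
        (Nat.one_le_iff_ne_zero.2 (Finsupp.mem_support_iff.1 hi)))
    have := coeff_pderiv (i := i) p (m - Finsupp.single i 1)
    rw [hp, coeff_zero, hm] at this
    exact (mul_eq_zero.1 this.symm).resolve_right (by positivity)

theorem trdeg_ratFn : Algebra.trdeg ℝ (RatFn n) = n := by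
  have : Algebra.IsAlgebraic (MvPolynomial (Fin n) ℝ) (RatFn n) :=
    IsLocalization.isAlgebraic _ (nonZeroDivisors (MvPolynomial (Fin n) ℝ))
  have := (IsTranscendenceBasis.mvPolynomial (Fin n) ℝ).algebraMap_comp (A := RatFn n)
  simpa using this.lift_cardinalMk_eq_trdeg.symm

/-- A rational function `f` is separably algebraic over `n` rational functions `J` with independent
differentials. A relation of minimal degree between `f` and the `J` works: not all its partial
derivatives vanish at `(f, J)`, and those with respect to the `J` vanish along with the one with
respect to `f`. -/
theorem exists_separable_relation {J : Fin n → RatFn n}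
    (hJ : LinearIndependent (RatFn n) fun b => fun j => RatFn.pderiv j (J b)) (f : RatFn n) :
    ∃ p : MvPolynomial (Option (Fin n)) ℝ,
      aeval (fun o : Option (Fin n) => o.elim f J) p = 0 ∧
      aeval (fun o : Option (Fin n) => o.elim f J) (pderiv none p) ≠ 0 := by
  set x : Option (Fin n) → RatFn n := fun o => o.elim f J with hx
  have hdep : ¬ AlgebraicIndependent ℝ x := by
    intro hind
    have := hind.cardinalMk_le_trdeg
    rw [trdeg_ratFn] at this
    simp only [Cardinal.mk_fintype, Fintype.card_option, Fintype.card_fin, Nat.cast_le] at this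
    omega
  have hex : ∃ d, ∃ p : MvPolynomial (Option (Fin n)) ℝ,
      p ≠ 0 ∧ aeval x p = 0 ∧ p.totalDegree = d := by
    by_contra! hcon
    refine hdep ((injective_iff_map_eq_zero _).2 fun p hp => ?_)
    by_contra hp0
    exact hcon _ p hp0 hp rfl
  classical
  obtain ⟨p, hp0, hp, hdeg⟩ := Nat.find_spec hex
  have hmin : ∀ i, aeval x (pderiv i p) = 0 → pderiv i p = 0 := by
    intro i hi
    by_contra h0
    exact Nat.find_min hex (hdeg ▸ totalDegree_pderiv_lt h0) ⟨_, h0, hi, rfl⟩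
  refine ⟨p, hp, fun hnone => ?_⟩
  have hsome : ∀ b, aeval x (pderiv (some b) p) = 0 := by
    refine Fintype.linearIndependent_iff.1 hJ _ ?_
    ext j
    have := derivation_aeval (RatFn.derivation j) x p
    rw [hp, map_zero, Fintype.sum_option, hnone, zero_mul, zero_add] at this
    simpa [hx] using this.symm
  have hC := eq_C_of_pderiv_eq_zero fun i => hmin i (by cases i; exacts [hnone, hsome _])
  rw [hC, aeval_C] at hp
  exact hp0 (by rw [hC, (map_eq_zero _).1 hp, C_0])

/-! ### Corresponding rational functions -/

/-- The pairs of elements of a field given by one and the same rational expression in the families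
`D` and `D'`. -/
def Corr {ι F : Type*} [Field F] [Algebra ℝ F] (D D' : ι → F) (f f' : F) : Prop :=
  ∃ P Q : MvPolynomial ι ℝ, aeval D Q ≠ 0 ∧ aeval D' Q ≠ 0 ∧
    f = aeval D P / aeval D Q ∧ f' = aeval D' P / aeval D' Q

namespace Corr

variable {ι F : Type*} [Field F] [Algebra ℝ F] {D D' : ι → F} {f f' g g' : F}

theorem of_aeval (P : MvPolynomial ι ℝ) : Corr D D' (aeval D P) (aeval D' P) :=
  ⟨P, 1, by simp, by simp, by simp, by simp⟩

theorem gen (i : ι) : Corr D D' (D i) (D' i) := by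
  simpa using of_aeval (D := D) (D' := D') (X i)

theorem add (hf : Corr D D' f f') (hg : Corr D D' g g') : Corr D D' (f + g) (f' + g') := by
  obtain ⟨P, Q, h, h', rfl, rfl⟩ := hf
  obtain ⟨R, S, k, k', rfl, rfl⟩ := hg
  exact ⟨P * S + Q * R, Q * S, by simp [h, k], by simp [h', k'], by simp [div_add_div _ _ h k],
    by simp [div_add_div _ _ h' k']⟩

theorem mul (hf : Corr D D' f f') (hg : Corr D D' g g') : Corr D D' (f * g) (f' * g') := by
  obtain ⟨P, Q, h, h', rfl, rfl⟩ := hf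
  obtain ⟨R, S, k, k', rfl, rfl⟩ := hg
  exact ⟨P * R, Q * S, by simp [h, k], by simp [h', k'], by simp [div_mul_div_comm],
    by simp [div_mul_div_comm]⟩

theorem neg (hf : Corr D D' f f') : Corr D D' (-f) (-f') := by
  simpa using (of_aeval (D := D) (D' := D') (-1)).mul hf

theorem sub (hf : Corr D D' f f') (hg : Corr D D' g g') : Corr D D' (f - g) (f' - g') := by
  simpa [sub_eq_add_neg] using hf.add hg.neg

theorem inv (hf : Corr D D' f f') (h0 : f ≠ 0) (h0' : f' ≠ 0) : Corr D D' f⁻¹ f'⁻¹ := by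
  obtain ⟨P, Q, h, h', rfl, rfl⟩ := hf
  exact ⟨Q, P, (div_ne_zero_iff.1 h0).1, (div_ne_zero_iff.1 h0').1, by simp, by simp⟩

theorem sum {κ : Type*} {s : Finset κ} {u u' : κ → F} (hu : ∀ i ∈ s, Corr D D' (u i) (u' i)) :
    Corr D D' (∑ i ∈ s, u i) (∑ i ∈ s, u' i) := by
  classical
  induction s using Finset.induction_on with
  | empty => simpa using of_aeval (D := D) (D' := D') 0
  | insert i s hi ih =>
    rw [Finset.sum_insert hi, Finset.sum_insert hi]
    exact (hu i (Finset.mem_insert_self i s)).add (ih fun j hj => hu j (Finset.mem_insert_of_mem hj))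

/-- Corresponding derivations on the generators give corresponding derivatives. -/
theorem derivation [Fintype ι] {d d' : Derivation ℝ F F} (hd : ∀ i, Corr D D' (d (D i)) (d' (D' i)))
    (hf : Corr D D' f f') : Corr D D' (d f) (d' f') := by
  obtain ⟨P, Q, h, h', rfl, rfl⟩ := hf
  have key : ∀ R : MvPolynomial ι ℝ, Corr D D' (d (aeval D R)) (d' (aeval D' R)) := by
    intro R
    rw [derivation_aeval, derivation_aeval]
    exact sum fun i _ => (of_aeval _).mul (hd i)
  simp only [Derivation.leibniz_div, smul_eq_mul, pow_two]
  have hQ := (of_aeval (D := D) (D' := D') Q).inv h h'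
  exact (hQ.mul hQ).mul (((of_aeval Q).mul (key P)).sub ((of_aeval P).mul (key Q)))

end Corr

/-! ### Derivatives of the components of the invariant map -/

/-- Indices of the components of `(J, U, Γ)`. -/
abbrev CompIndex (n : ℕ) : Type := Fin n ⊕ (Fin n × Fin n) ⊕ (Fin n × Fin n × Fin n)

/-- The components of the rational map `(J(h), U(h), Γ(h))` as one family. -/
def comps (I : Fin n → JetFraction n) (h : MvPolynomial (Fin n) ℝ) : CompIndex n → RatFn n :=
  Sum.elim (fun b => (I b).value h) (Sum.elim (fun p => frameCoeff I h p.1 p.2)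
    fun p => christoffel h p.1 p.2.1 p.2.2)

/-- A family of numbers, arranged as a point of the target of the invariant map. -/
def tuple (c : CompIndex n → ℝ) :
    (Fin n → ℝ) × (Fin n → Fin n → ℝ) × (Fin n → Fin n → Fin n → ℝ) :=
  (fun b => c (.inl b), fun a b => c (.inr (.inl (a, b))),
    fun a b d => c (.inr (.inr (a, b, d))))

theorem tuple_mem_piImage {I : Fin n → JetFraction n} {h : MvPolynomial (Fin n) ℝ}
    {c : CompIndex n → ℝ} :
    tuple c ∈ piImage I h ↔ ∃ v, ∀ i, (comps I h i).HasValue v (c i) := by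
  refine exists_congr fun v => ⟨?_, fun H => ⟨fun i => H (.inl i), fun a b => H (.inr (.inl (a, b))),
    fun a b d => H (.inr (.inr (a, b, d)))⟩⟩
  rintro ⟨hJ, hU, hΓ⟩ (b | ⟨a, b⟩ | ⟨a, b, d⟩)
  exacts [hJ b, hU a b, hΓ a b d]

/-- A polynomial relation between the components along `h` holds on `Π_h`, and a relation holding on
`Π_{h'}` holds between the components along `h'`. -/
theorem aeval_comps_eq_zero {I : Fin n → JetFraction n} {h h' : MvPolynomial (Fin n) ℝ}
    (hPi : piImage I h' ⊆ piImage I h) {P : MvPolynomial (CompIndex n) ℝ}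
    (hP : aeval (comps I h) P = 0) : aeval (comps I h') P = 0 := by
  by_contra hne
  obtain ⟨v', c, hc, hPc⟩ := RatFn.exists_hasValue_eval_ne_zero _ hne
  obtain ⟨v, hv⟩ := tuple_mem_piImage.1 (hPi (tuple_mem_piImage.2 ⟨v', hc⟩))
  have h1 := RatFn.HasValue.aeval hv P
  have h2 := RatFn.hasValue_algebraMap (v := v) (0 : MvPolynomial (Fin n) ℝ)
  rw [map_zero, map_zero] at h2
  rw [hP] at h1
  exact hPc (h1.unique h2)

/-- If the images coincide, the frames act on the components by the same rational expressions. -/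
theorem corr_frameDeriv_comps {I : Fin n → JetFraction n} {h h' : MvPolynomial (Fin n) ℝ}
    (hg : InGeneralPositionAlong I h) (hPi : piImage I h = piImage I h') (a : Fin n)
    (i : CompIndex n) :
    Corr (comps I h) (comps I h') (frameDerivation h a (comps I h i))
      (frameDerivation h' a (comps I h' i)) := by
  obtain ⟨p, hp0, hp1⟩ := exists_separable_relation hg.2 (comps I h i)
  let e : Option (Fin n) → CompIndex n := fun o => o.elim i Sum.inl
  have he : ∀ g : MvPolynomial (Fin n) ℝ, (fun o : Option (Fin n) =>
      o.elim (comps I g i) fun b => (I b).value g) = comps I g ∘ e := by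
    intro g; ext o; cases o <;> rfl
  rw [he, ← aeval_rename] at hp0 hp1
  have hp0' := aeval_comps_eq_zero hPi.ge hp0
  have hp1' : aeval (comps I h') (rename e (pderiv none p)) ≠ 0 := fun h0 =>
    hp1 (aeval_comps_eq_zero hPi.le h0)
  -- The derivative of the relation expresses the derivative of the component through `U`.
  have key : ∀ g : MvPolynomial (Fin n) ℝ, aeval (comps I g) (rename e p) = 0 →
      aeval (comps I g) (rename e (pderiv none p)) ≠ 0 →
      frameDerivation g a (comps I g i) =
        -(∑ b, aeval (comps I g) (rename e (pderiv (some b) p)) *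
          comps I g (.inr (.inl (a, b)))) * (aeval (comps I g) (rename e (pderiv none p)))⁻¹ := by
    intro g h0 h1
    have := derivation_aeval (frameDerivation g a) (comps I g ∘ e) p
    rw [← aeval_rename, h0, map_zero, Fintype.sum_option] at this
    rw [eq_mul_inv_iff_mul_eq₀ h1, eq_neg_iff_add_eq_zero, mul_comm, this]
    simp only [aeval_rename, frameDerivation_apply]
    rfl
  rw [key h hp0 hp1, key h' hp0' hp1']
  exact (Corr.sum fun b _ => (Corr.of_aeval _).mul (Corr.gen _)).neg.mul
    ((Corr.of_aeval _).inv hp1 hp1')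

/-! ### The Taylor expansion of a form in the moving frame -/

/-- A derivation applied to the coefficients of a polynomial. -/
def mapCoeff {F : Type*} [Field F] [Algebra ℝ F] (d : Derivation ℝ F F)
    (p : MvPolynomial (Fin n) F) : MvPolynomial (Fin n) F :=
  ∑ l ∈ p.support, monomial l (d (coeff l p))

theorem coeff_mapCoeff {F : Type*} [Field F] [Algebra ℝ F] (d : Derivation ℝ F F)
    (p : MvPolynomial (Fin n) F) (m : Fin n →₀ ℕ) : coeff m (mapCoeff d p) = d (coeff m p) := by
  classical
  simp only [mapCoeff, coeff_sum, coeff_monomial, Finset.sum_ite_eq']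
  split_ifs with hm
  · rfl
  · rw [notMem_support_iff.1 hm, map_zero]

/-- A derivation of a field, extended to polynomials by its action on the coefficients. -/
def coeffDerivation {F : Type*} [Field F] [Algebra ℝ F] (d : Derivation ℝ F F) :
    Derivation ℝ (MvPolynomial (Fin n) F) (MvPolynomial (Fin n) F) :=
  Derivation.mk'
    { toFun := mapCoeff d
      map_add' := fun p q => by ext m; simp only [coeff_mapCoeff, coeff_add, map_add]
      map_smul' := fun r p => by
        ext m
        simp only [coeff_mapCoeff, coeff_smul, RingHom.id_apply, Derivation.map_smul] }
    (fun p q => by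
      classical
      ext m
      simp only [LinearMap.coe_mk, AddHom.coe_mk, coeff_mapCoeff, smul_eq_mul, coeff_add, coeff_mul,
        map_sum, Derivation.leibniz, Finset.sum_add_distrib]
      congr 1
      exact Finset.sum_equiv (Equiv.prodComm _ _) (by simp [add_comm]) fun _ _ => rfl)

@[simp] theorem coeff_coeffDerivation {F : Type*} [Field F] [Algebra ℝ F] (d : Derivation ℝ F F)
    (p : MvPolynomial (Fin n) F) (m : Fin n →₀ ℕ) :
    coeff m (coeffDerivation d p) = d (coeff m p) := coeff_mapCoeff d p m

/-- The point `x + ∑ sₐ eₐ`, with indeterminate `s`. -/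
def movingPoint (h : MvPolynomial (Fin n) ℝ) (i : Fin n) : MvPolynomial (Fin n) (RatFn n) :=
  C (algebraMap (MvPolynomial (Fin n) ℝ) (RatFn n) (X i)) + ∑ a, C (frameOf h a i) * X a

/-- The Taylor expansion `h (x + ∑ sₐ eₐ)` of `h` in the moving frame, as a polynomial in `s`. -/
def frameTaylor (h : MvPolynomial (Fin n) ℝ) : MvPolynomial (Fin n) (RatFn n) :=
  aeval (movingPoint h) h

theorem frameDerivation_X (h : MvPolynomial (Fin n) ℝ) (b i : Fin n) :
    frameDerivation h b (algebraMap (MvPolynomial (Fin n) ℝ) (RatFn n) (X i)) = frameOf h b i := by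
  classical
  simp [frameDeriv, RatFn.pderiv_algebraMap, pderiv_X, Pi.single_apply, apply_ite]

/-- The structure equation `∇_{e_b} e_a = ∑_c Γ_{ba}^c e_c`. -/
theorem frameDerivation_frameOf {h : MvPolynomial (Fin n) ℝ} (hdet : (frameOf h).det ≠ 0)
    (b a i : Fin n) :
    frameDerivation h b (frameOf h a i) = ∑ c, christoffel h b a c * frameOf h c i := by
  have : Matrix.vecMul (christoffel h b a) (frameOf h) =
      fun i => frameDeriv h b (frameOf h a i) := by
    change Matrix.vecMul (Matrix.vecMul _ _) _ = _
    rw [Matrix.vecMul_vecMul, Matrix.nonsing_inv_mul _ (isUnit_iff_ne_zero.2 hdet),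
      Matrix.vecMul_one]
  rw [frameDerivation_apply]
  exact (congrFun this i).symm

/-- The derivatives of the Taylor expansion with respect to `s` are expressed through its derivative
along the frame and the Christoffel symbols. -/
theorem pderiv_frameTaylor {h : MvPolynomial (Fin n) ℝ} (hdet : (frameOf h).det ≠ 0) (b : Fin n) :
    pderiv b (frameTaylor h) = coeffDerivation (frameDerivation h b) (frameTaylor h) -
      ∑ a, ∑ c, X a * (C (christoffel h b a c) * pderiv c (frameTaylor h)) := by
  classical
  have hC : ∀ (d : Derivation ℝ (RatFn n) (RatFn n)) (f : RatFn n),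
      coeffDerivation (n := n) d (C f) = C (d f) := by
    intro d f
    ext m
    rw [coeff_coeffDerivation, coeff_C, coeff_C]
    split_ifs <;> simp
  have hX : ∀ (d : Derivation ℝ (RatFn n) (RatFn n)) (a : Fin n),
      coeffDerivation (n := n) d (X a) = 0 := by
    intro d a
    ext m
    rw [coeff_coeffDerivation, coeff_X, coeff_zero]
    split_ifs <;> simp
  have hs : ∀ c, pderiv c (frameTaylor h) =
      ∑ i, aeval (movingPoint h) (pderiv i h) * C (frameOf h c i) := by
    intro c
    have := derivation_aeval ((pderiv c : Derivation (RatFn n) _ _).restrictScalars ℝ)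
      (movingPoint h) h
    refine this.trans (Finset.sum_congr rfl fun i _ => ?_)
    congr 1
    simp [movingPoint, Derivation.leibniz, pderiv_X, Pi.single_apply]
  rw [eq_sub_iff_add_eq]
  conv_rhs => rw [frameTaylor, derivation_aeval]
  have hmp : ∀ i, coeffDerivation (frameDerivation h b) (movingPoint h i) =
      C (frameOf h b i) + ∑ a, ∑ c, X a * (C (christoffel h b a c) * C (frameOf h c i)) := by
    intro i
    simp only [movingPoint, map_add, map_sum, Derivation.leibniz, hC, hX, frameDerivation_X,
      frameDerivation_frameOf hdet, smul_eq_mul, mul_zero, zero_add, map_mul, Finset.mul_sum]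
  simp only [hmp, mul_add, Finset.sum_add_distrib, ← hs]
  congr 1
  simp only [hs, Finset.mul_sum]
  rw [Finset.sum_congr rfl fun a _ => Finset.sum_comm, Finset.sum_comm]
  exact Finset.sum_congr rfl fun i _ => Finset.sum_congr rfl fun a _ =>
    Finset.sum_congr rfl fun c _ => by ring

/-- The Taylor coefficients in the moving frame are obtained by repeated differentiation along the
frame, so those of `h` and `h'` correspond when the images coincide. -/
theorem corr_coeff_frameTaylor {k : ℕ} (hn : n ≠ 0) {I : Fin n → JetFraction n}
    (hI : IsInvariantSystem k I) {h h' : MvPolynomial (Fin n) ℝ}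
    (hdet : (frameOf h).det ≠ 0) (hdet' : (frameOf h').det ≠ 0)
    (hg : InGeneralPositionAlong I h) (hPi : piImage I h = piImage I h') (m : Fin n →₀ ℕ) :
    Corr (comps I h) (comps I h') (coeff m (frameTaylor h)) (coeff m (frameTaylor h')) := by
  classical
  -- A coefficient of positive degree is one of a partial derivative, which `pderiv_frameTaylor`
  -- expresses through coefficients of lower degree.
  induction hd : m.degree using Nat.strong_induction_on generalizing m with
  | _ d ih =>
  subst hd
  rcases eq_or_ne m 0 with rfl | hm
  · let i : Fin n := ⟨n - 1, by omega⟩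
    have hi : I i = theta0 n := hI.2 i (by simp only [i]; omega)
    have key : ∀ g : MvPolynomial (Fin n) ℝ, coeff 0 (frameTaylor g) = comps I g (.inl i) := by
      intro g
      have h1 : comps I g (.inl i) = algebraMap _ (RatFn n) g := by
        simp only [comps, Sum.elim_inl, hi, JetFraction.value, theta0, aeval_X, map_one, div_one]
        rfl
      have h2 : ∀ q : MvPolynomial (Fin n) ℝ,
          constantCoeff (aeval (movingPoint g) q) = algebraMap _ (RatFn n) q := by
        intro q
        induction q using MvPolynomial.induction_on with
        | C r => rw [aeval_C, MvPolynomial.algebraMap_apply, constantCoeff_C, RatFn.algebraMap_real]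
        | add p q hp hq => simp [hp, hq]
        | mul_X p i hp =>
          rw [map_mul, map_mul, hp, aeval_X, map_mul]
          simp [movingPoint]
      rw [h1, ← h2, constantCoeff_eq, frameTaylor]
    rw [key, key]
    exact Corr.gen _
  · obtain ⟨b, hb⟩ := Finsupp.support_nonempty_iff.2 hm
    obtain ⟨l, rfl⟩ : ∃ l, m = l + Finsupp.single b 1 :=
      ⟨m - Finsupp.single b 1, (tsub_add_cancel_of_le (Finsupp.single_le_iff.2
        (Nat.one_le_iff_ne_zero.2 (Finsupp.mem_support_iff.1 hb)))).symm⟩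
    have hdeg : (l + Finsupp.single b 1).degree = l.degree + 1 := by
      rw [map_add, Finsupp.degree_single]
    have hl : Corr (comps I h) (comps I h') (coeff l (pderiv b (frameTaylor h)))
        (coeff l (pderiv b (frameTaylor h'))) := by
      rw [pderiv_frameTaylor hdet, pderiv_frameTaylor hdet', coeff_sub, coeff_sub,
        coeff_coeffDerivation, coeff_coeffDerivation, coeff_sum, coeff_sum]
      refine Corr.sub (Corr.derivation (corr_frameDeriv_comps hg hPi b)
        (ih _ (by omega) l rfl)) (Corr.sum fun a _ => ?_)
      rw [coeff_sum, coeff_sum]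
      refine Corr.sum fun c _ => ?_
      rw [coeff_X_mul', coeff_X_mul']
      split_ifs with ha
      · rw [coeff_C_mul, coeff_C_mul, coeff_pderiv, coeff_pderiv]
        have hle : Finsupp.single a 1 ≤ l := Finsupp.single_le_iff.2
          (Nat.one_le_iff_ne_zero.2 (Finsupp.mem_support_iff.1 ha))
        have hdeg' : (l - Finsupp.single a 1 + Finsupp.single c 1).degree = l.degree := by
          have := congrArg Finsupp.degree (tsub_add_cancel_of_le hle)
          rw [map_add, Finsupp.degree_single] at this ⊢
          exact this
        refine (Corr.gen (.inr (.inr (b, a, c)))).mul ((ih _ (by omega) _ hdeg').mul ?_)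
        have hconst := Corr.of_aeval (D := comps I h) (D' := comps I h')
          (C ((((l - Finsupp.single a 1 : Fin n →₀ ℕ) c : ℕ) : ℝ) + 1))
        rw [aeval_C, aeval_C, map_add, map_one, map_natCast] at hconst
        exact hconst
      · simpa using Corr.of_aeval (D := comps I h) (D' := comps I h') 0
    rw [coeff_pderiv, coeff_pderiv] at hl
    have hc := hl.mul (Corr.of_aeval (D := comps I h) (D' := comps I h') (C ((l b : ℝ) + 1)⁻¹))
    have : CharZero (RatFn n) := charZero_of_injective_algebraMap (algebraMap ℝ _).injective
    have h0 : ((l b : RatFn n) + 1) ≠ 0 := Nat.cast_add_one_ne_zero _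
    simpa [mul_assoc, h0] using hc

/-! ### Reconstruction of a form from one point of the image -/

/-- Matrix inversion is compatible with evaluation at a point. -/
theorem hasValue_nonsing_inv {M : Matrix (Fin n) (Fin n) (RatFn n)} {v : Fin n → ℝ}
    {c : Matrix (Fin n) (Fin n) ℝ} (hM : ∀ i j, (M i j).HasValue v (c i j)) (hc : c.det ≠ 0)
    (i j : Fin n) : (M⁻¹ i j).HasValue v (c⁻¹ i j) := by
  let N : Matrix (Fin n) (Fin n) (RatFn.valueSubalgebra v) := Matrix.of fun i j => (hM i j).lift
  have hN : IsUnit N.det := by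
    refine RatFn.isUnit_of_toReal_ne_zero ?_
    rw [AlgHom.map_det]
    exact hc
  have h := Matrix.mul_nonsing_inv _ hN
  have h1 : M⁻¹ = N⁻¹.map (RatFn.toRatFn v) := by
    refine Matrix.inv_eq_right_inv ?_
    have := congrArg (RingHom.mapMatrix (RatFn.toRatFn v : _ →+* RatFn n)) h
    rw [map_mul, map_one] at this
    exact this
  have h2 : c⁻¹ = N⁻¹.map (RatFn.toReal v) := by
    refine Matrix.inv_eq_right_inv ?_
    have := congrArg (RingHom.mapMatrix (RatFn.toReal v : _ →+* ℝ)) h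
    rw [map_mul, map_one] at this
    exact this
  rw [h1, h2]
  exact RatFn.hasValue_toRatFn _

theorem det_ne_zero_of_hasValue {M : Matrix (Fin n) (Fin n) (RatFn n)} {v : Fin n → ℝ}
    {c : Matrix (Fin n) (Fin n) ℝ} (hM : ∀ i j, (M i j).HasValue v (c i j)) (hc : c.det ≠ 0) :
    M.det ≠ 0 := by
  let N : Matrix (Fin n) (Fin n) (RatFn.valueSubalgebra v) := Matrix.of fun i j => (hM i j).lift
  have hN : IsUnit N.det := by
    refine RatFn.isUnit_of_toReal_ne_zero ?_
    rw [AlgHom.map_det]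
    exact hc
  have h := (hN.map (RatFn.toRatFn v)).ne_zero
  rw [AlgHom.map_det] at h
  exact h

theorem frameOf_mul_jacobian (I : Fin n → JetFraction n) (h : MvPolynomial (Fin n) ℝ) :
    frameOf h * Matrix.of (fun i b => RatFn.pderiv i ((I b).value h)) =
      Matrix.of (frameCoeff I h) := by
  ext a b; rfl

theorem det_frameCoeff_ne_zero {I : Fin n → JetFraction n} {h : MvPolynomial (Fin n) ℝ}
    (hdet : (frameOf h).det ≠ 0) (hg : InGeneralPositionAlong I h) :
    (Matrix.of (frameCoeff I h)).det ≠ 0 := by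
  rw [← frameOf_mul_jacobian, Matrix.det_mul]
  refine mul_ne_zero hdet ?_
  rw [← Matrix.det_transpose]
  have : LinearIndependent (RatFn n)
      (Matrix.of (fun i b => RatFn.pderiv i ((I b).value h))).transpose.row := hg.2
  rw [Matrix.linearIndependent_rows_iff_isUnit, Matrix.isUnit_iff_isUnit_det] at this
  exact this.ne_zero

/-- The value at `v` of the inverse of the frame need not be invertible, since the frame may have a
pole at `v`; but it exists when `J` and `U` are defined and `U` is invertible at `v`, and then `h` is
recovered from the values of its Taylor coefficients in the frame. -/
theorem exists_eq_linSub {I : Fin n → JetFraction n} (hn : n ≠ 0)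
    {h : MvPolynomial (Fin n) ℝ} (hdet : (frameOf h).det ≠ 0) {v : Fin n → ℝ}
    {c : CompIndex n → ℝ} (hc : ∀ i, (comps I h i).HasValue v (c i))
    (hU : (Matrix.of fun a b => c (.inr (.inl (a, b)))).det ≠ 0) {S : Finset (Fin n →₀ ℕ)}
    (hS : (frameTaylor h).support ⊆ S) {g : (Fin n →₀ ℕ) → ℝ}
    (hgv : ∀ m ∈ S, (coeff m (frameTaylor h)).HasValue v (g m)) :
    ∃ B : Matrix (Fin n) (Fin n) ℝ, h = linSub B (∑ m ∈ S, C (g m) *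
      ∏ a : Fin n, (X a - C (if (a : ℕ) + 1 = n then 1 else 0)) ^ m a) := by
  have hW : ∀ i b, ∃ d, (RatFn.pderiv i ((I b).value h)).HasValue v d := fun i b =>
    (hc (.inl b)).pderiv i
  choose w hw using hW
  have hUinv := hasValue_nonsing_inv (M := Matrix.of (frameCoeff I h))
    (c := Matrix.of fun a b => c (.inr (.inl (a, b)))) (fun a b => hc (.inr (.inl (a, b)))) hU
  set cU : Matrix (Fin n) (Fin n) ℝ := Matrix.of fun a b => c (.inr (.inl (a, b)))
  have hUne : (Matrix.of (frameCoeff I h)).det ≠ 0 :=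
    det_ne_zero_of_hasValue (fun a b => hc (.inr (.inl (a, b)))) hU
  have hEinv : (frameOf h)⁻¹ =
      Matrix.of (fun i b => RatFn.pderiv i ((I b).value h)) * (Matrix.of (frameCoeff I h))⁻¹ := by
    refine Matrix.inv_eq_right_inv ?_
    rw [← mul_assoc, frameOf_mul_jacobian, Matrix.mul_nonsing_inv _ (isUnit_iff_ne_zero.2 hUne)]
  let B : Matrix (Fin n) (Fin n) ℝ := (Matrix.of w * cU⁻¹).transpose
  have hB : ∀ a i, ((frameOf h)⁻¹ i a).HasValue v (B a i) := by
    intro a i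
    have hBa : B a i = ∑ b, w i b * cU⁻¹ b a := rfl
    rw [hEinv, Matrix.mul_apply, hBa]
    exact RatFn.HasValue.sum fun b _ => (hw i b).mul (hUinv b a)
  refine ⟨B, MvPolynomial.funext fun y => ?_⟩
  let δ : Fin n → ℝ := fun a => if (a : ℕ) + 1 = n then 1 else 0
  let t : Fin n → RatFn n := fun a =>
    Matrix.vecMul (fun i => algebraMap ℝ (RatFn n) (y i)) (frameOf h)⁻¹ a -
      algebraMap ℝ (RatFn n) (δ a)
  have hconst : ∀ r : ℝ, (algebraMap ℝ (RatFn n) r).HasValue v r := fun r => by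
    simpa [← RatFn.algebraMap_real] using RatFn.hasValue_algebraMap (v := v) (C r)
  have ht : ∀ a, (t a).HasValue v (B.mulVec y a - δ a) := by
    intro a
    have h1 : (Matrix.vecMul (fun i => algebraMap ℝ (RatFn n) (y i)) (frameOf h)⁻¹ a).HasValue v
        (B.mulVec y a) := by
      simp only [Matrix.vecMul, Matrix.mulVec, dotProduct, mul_comm (B a _)]
      exact RatFn.HasValue.sum fun i _ => (hconst (y i)).mul (hB a i)
    have h2 := h1.add ((hconst (-1)).mul (hconst (δ a)))
    simpa [t, sub_eq_add_neg] using h2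
  -- Evaluating the Taylor expansion at the frame coordinates of `y - x` gives back `h y`.
  have hpoint : ∀ i, eval t (movingPoint h i) = algebraMap ℝ (RatFn n) (y i) := by
    intro i
    have h1 : Matrix.vecMul t (frameOf h) i =
        algebraMap ℝ (RatFn n) (y i) - algebraMap (MvPolynomial (Fin n) ℝ) (RatFn n) (X i) := by
      have ht' : t = Matrix.vecMul (fun i => algebraMap ℝ (RatFn n) (y i)) (frameOf h)⁻¹ -
          fun a => algebraMap ℝ (RatFn n) (δ a) := rfl
      have hδ : Matrix.vecMul (fun a => algebraMap ℝ (RatFn n) (δ a)) (frameOf h) i =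
          algebraMap (MvPolynomial (Fin n) ℝ) (RatFn n) (X i) := by
        have hlast : ∀ a : Fin n, (a : ℕ) + 1 = n ↔ a = ⟨n - 1, by omega⟩ := by
          intro a; rw [Fin.ext_iff]; simp only; omega
        simp only [Matrix.vecMul, dotProduct, δ, hlast, apply_ite (algebraMap ℝ (RatFn n)), map_one,
          map_zero, ite_mul, one_mul, zero_mul, Finset.sum_ite_eq', Finset.mem_univ, if_true]
        have : n - 1 + 1 = n := by omega
        simp [frameOf, Jet3.frame, this, jetOf]
      rw [ht', Matrix.sub_vecMul, Matrix.vecMul_vecMul,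
        Matrix.nonsing_inv_mul _ (isUnit_iff_ne_zero.2 hdet), Matrix.vecMul_one, Pi.sub_apply, hδ]
    have h2 : eval t (movingPoint h i) =
        algebraMap (MvPolynomial (Fin n) ℝ) (RatFn n) (X i) + Matrix.vecMul t (frameOf h) i := by
      simp [movingPoint, Matrix.vecMul, dotProduct, mul_comm]
    rw [h2, h1]
    ring
  have hTaylor : eval t (frameTaylor h) = algebraMap ℝ (RatFn n) (eval y h) := by
    have h1 : ∀ q : MvPolynomial (Fin n) ℝ,
        eval t (aeval (movingPoint h) q) = algebraMap ℝ (RatFn n) (eval y q) := by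
      intro q
      induction q using MvPolynomial.induction_on with
      | C r => rw [aeval_C, MvPolynomial.algebraMap_apply, eval_C, eval_C]
      | add p q hp hq => simp [hp, hq]
      | mul_X p i hp => simp [hp, hpoint]
    exact h1 h
  have hsum : eval t (frameTaylor h) = ∑ m ∈ S, coeff m (frameTaylor h) * ∏ a, t a ^ m a := by
    rw [eval_eq']
    refine Finset.sum_subset hS fun m _ hm => ?_
    rw [notMem_support_iff.1 hm, zero_mul]
  have hval : (eval t (frameTaylor h)).HasValue v
      (∑ m ∈ S, g m * ∏ a, (B.mulVec y a - δ a) ^ m a) := by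
    rw [hsum]
    exact RatFn.HasValue.sum fun m hm => (hgv m hm).mul
      (RatFn.HasValue.prod fun a _ => (ht a).pow (m a))
  rw [hTaylor] at hval
  rw [(hconst _).unique hval, eval_linSub]
  simp [δ]

/-- A form with a nondegenerate Hessian does not factor through a singular linear map. -/
theorem det_ne_zero_of_eq_linSub {h q : MvPolynomial (Fin n) ℝ} {B : Matrix (Fin n) (Fin n) ℝ}
    (hh : (Matrix.of (jetPoly h).u2).det ≠ 0) (hB : h = linSub B q) : B.det ≠ 0 := by
  intro h0
  refine hh ?_
  have : Matrix.of (jetPoly h).u2 =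
      (B.map C).transpose * (Matrix.of (jetPoly q).u2).map (linSub B) * B.map C := by
    refine Matrix.ext fun i j => ?_
    simp only [jetOf, RingHom.id_apply, hB, pderiv_linSub, Matrix.of_apply, Matrix.mul_apply,
      Matrix.map_apply, Matrix.transpose_apply, map_sum, pderiv_C_mul, Finset.mul_sum,
      Finset.sum_mul]
    exact Finset.sum_congr rfl fun p _ => Finset.sum_congr rfl fun q _ => by ring
  have hC : (B.map C : Matrix (Fin n) (Fin n) (MvPolynomial (Fin n) ℝ)).det = C B.det :=
    (RingHom.map_det C B).symm
  rw [this, Matrix.det_mul, hC, h0, C_0, mul_zero]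

theorem Equivalent.trans {h h' h'' : MvPolynomial (Fin n) ℝ} (e : Equivalent h h')
    (e' : Equivalent h' h'') : Equivalent h h'' := by
  obtain ⟨A, rfl⟩ := equivalent_iff.1 e
  obtain ⟨B, rfl⟩ := equivalent_iff.1 e'
  exact equivalent_iff.2 ⟨A * B, by rw [linSub_linSub, Units.val_mul]⟩

theorem equivalent_of_det_ne_zero {h q : MvPolynomial (Fin n) ℝ} {B : Matrix (Fin n) (Fin n) ℝ}
    (hB : B.det ≠ 0) (e : h = linSub B q) : Equivalent q h :=
  equivalent_iff.2 ⟨Matrix.GeneralLinearGroup.mkOfDetNeZero B hB, e⟩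

/-- Forms with the same image are equivalent: at one suitable point of the image both are recovered,
up to a linear change of coordinates, from the same values of Taylor coefficients. -/
theorem equivalent_of_piImage_eq {k : ℕ} (hn : n ≠ 0) {I : Fin n → JetFraction n}
    (hI : IsInvariantSystem k I) {h h' : MvPolynomial (Fin n) ℝ}
    (hdet : (frameOf h).det ≠ 0) (hdet' : (frameOf h').det ≠ 0)
    (hH : (Matrix.of (jetPoly h).u2).det ≠ 0) (hH' : (Matrix.of (jetPoly h').u2).det ≠ 0)
    (hg : InGeneralPositionAlong I h) (hPi : piImage I h = piImage I h') : Equivalent h h' := by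
  classical
  choose P Q hQ hQ' hPQ hPQ' using corr_coeff_frameTaylor hn hI hdet hdet' hg hPi
  let S := (frameTaylor h).support ∪ (frameTaylor h').support
  let M : Matrix (Fin n) (Fin n) (MvPolynomial (CompIndex n) ℝ) :=
    Matrix.of fun a b => X (.inr (.inl (a, b)))
  have hR : aeval (comps I h) (M.det * ∏ m ∈ S, Q m) ≠ 0 := by
    rw [map_mul, map_prod]
    refine mul_ne_zero ?_ (Finset.prod_ne_zero_iff.2 fun m _ => hQ m)
    rw [AlgHom.map_det]
    convert det_frameCoeff_ne_zero hdet hg using 2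
    ext a b
    simp [M, comps]
  obtain ⟨v, c, hc, hRc⟩ := RatFn.exists_hasValue_eval_ne_zero _ hR
  obtain ⟨v', hc'⟩ := tuple_mem_piImage.1 (hPi.le (tuple_mem_piImage.2 ⟨v, hc⟩))
  rw [map_mul, map_prod, mul_ne_zero_iff, Finset.prod_ne_zero_iff, RingHom.map_det] at hRc
  have hU : (Matrix.of fun a b => c (.inr (.inl (a, b)))).det ≠ 0 := by
    convert hRc.1 using 2
    ext a b
    simp [M]
  let g : (Fin n →₀ ℕ) → ℝ := fun m => eval c (P m) * (eval c (Q m))⁻¹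
  obtain ⟨B, hB⟩ := exists_eq_linSub (g := g) hn hdet hc hU Finset.subset_union_left (S := S)
    fun m hm => by
      rw [hPQ, div_eq_mul_inv]
      exact (RatFn.HasValue.aeval hc _).mul ((RatFn.HasValue.aeval hc _).inv (hRc.2 m hm))
  obtain ⟨B', hB'⟩ := exists_eq_linSub (g := g) hn hdet' hc' hU Finset.subset_union_right (S := S)
    fun m hm => by
      rw [hPQ', div_eq_mul_inv]
      exact (RatFn.HasValue.aeval hc' _).mul ((RatFn.HasValue.aeval hc' _).inv (hRc.2 m hm))
  exact (equivalent_of_det_ne_zero (det_ne_zero_of_eq_linSub hH hB) hB).symm.trans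
    (equivalent_of_det_ne_zero (det_ne_zero_of_eq_linSub hH' hB') hB')

/-! ### Invariants in general position along equivalent regular forms -/

/-- The matrix of partial derivatives of a family of rational functions. -/
def jacobian (J : Fin n → RatFn n) : Matrix (Fin n) (Fin n) (RatFn n) :=
  Matrix.of fun b j => RatFn.pderiv j (J b)

theorem inGeneralPositionAlong_iff {I : Fin n → JetFraction n} {h : MvPolynomial (Fin n) ℝ} :
    InGeneralPositionAlong I h ↔ (∀ i, along h (I i).den ≠ 0) ∧
      (jacobian fun b => (I b).value h).det ≠ 0 := by
  refine and_congr (forall_congr' fun i => ?_) ?_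
  · rw [aeval_jetVar, ne_eq, FaithfulSMul.algebraMap_eq_zero_iff]
  · change LinearIndependent (RatFn n) (jacobian fun b => (I b).value h).row ↔ _
    rw [Matrix.linearIndependent_rows_iff_isUnit, Matrix.isUnit_iff_isUnit_det,
      isUnit_iff_ne_zero]

theorem jacobian_ratSub (A : GL (Fin n) ℝ) (J : Fin n → RatFn n) :
    jacobian (fun b => ratSub A (J b)) = (jacobian J).map (ratSub A) * constMatrix A.val := by
  ext b j
  simp [jacobian, pderiv_ratSub, Matrix.mul_apply, constMatrix, mul_comm]

theorem hasFDerivAt_eval (p : MvPolynomial (Fin n) ℝ) (v : Fin n → ℝ) :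
    HasFDerivAt (fun w => eval w p)
      (∑ j, eval v (pderiv j p) • ContinuousLinearMap.proj (R := ℝ) (φ := fun _ => ℝ) j) v := by
  classical
  induction p using MvPolynomial.induction_on with
  | C r => simpa using hasFDerivAt_const r v
  | add p q hp hq =>
    simp only [map_add, add_smul, Finset.sum_add_distrib]
    exact hp.add hq
  | mul_X p i hp =>
    have hX : HasFDerivAt (fun w : Fin n → ℝ => w i)
        (ContinuousLinearMap.proj (R := ℝ) (φ := fun _ => ℝ) i) v := hasFDerivAt_apply i v
    have := hp.mul hX
    simp only [map_mul, eval_X]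
    refine this.congr_fderiv ?_
    ext w
    simp [Derivation.leibniz, pderiv_X, Pi.single_apply, add_mul, Finset.sum_add_distrib, mul_assoc,
      Finset.mul_sum, apply_ite]

theorem fderiv_valueAt {I : JetFraction n} {h : MvPolynomial (Fin n) ℝ} {v : Fin n → ℝ}
    (hden : eval (jetAt h v).coord I.den ≠ 0) (j : Fin n) :
    (RatFn.pderiv j (I.value h)).HasValue v (fderiv ℝ (I.valueAt h) v (Pi.single j 1)) := by
  classical
  rw [← eval_along] at hden
  have hfun : I.valueAt h = fun w => eval w (along h I.num) * (eval w (along h I.den))⁻¹ := by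
    ext w
    rw [JetFraction.valueAt, eval_along, eval_along, div_eq_mul_inv]
  have hd := (hasFDerivAt_eval (along h I.num) v).mul
    ((hasDerivAt_inv hden).comp_hasFDerivAt v (hasFDerivAt_eval (along h I.den) v))
  have hne : along h I.den ≠ 0 := by rintro h0; simp [h0] at hden
  refine ⟨_, _, ?_, by rw [value_eq, RatFn.pderiv_div _ _ _ hne], ?_⟩
  · simpa using hden
  · have hd' := hd.congr_of_eventuallyEq (Filter.EventuallyEq.of_eq hfun)
    rw [hd'.fderiv]
    simp [Pi.single_apply]
    field_simp
    ring

theorem det_jacobian_ne_zero {I : Fin n → JetFraction n} {h : MvPolynomial (Fin n) ℝ}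
    {v : Fin n → ℝ} (hden : ∀ i, eval (jetAt h v).coord (I i).den ≠ 0)
    (hli : LinearIndependent ℝ fun i => fderiv ℝ ((I i).valueAt h) v) :
    (jacobian fun b => (I b).value h).det ≠ 0 := by
  classical
  refine det_ne_zero_of_hasValue (fun b j => fderiv_valueAt (hden b) j) (v := v)
    (c := Matrix.of fun b j => fderiv ℝ ((I b).valueAt h) v (Pi.single j 1)) ?_
  let T : ((Fin n → ℝ) →L[ℝ] ℝ) →ₗ[ℝ] (Fin n → ℝ) :=
    { toFun := fun L j => L (Pi.single j 1)
      map_add' := fun _ _ => rfl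
      map_smul' := fun _ _ => rfl }
  have hT : LinearMap.ker T = ⊥ := by
    refine LinearMap.ker_eq_bot'.2 fun L hL => ?_
    refine ContinuousLinearMap.coe_injective (LinearMap.pi_ext' fun j => LinearMap.ext_ring ?_)
    have hj : L (Pi.single j 1) = 0 := congrFun hL j
    simpa using hj
  have : LinearIndependent ℝ
      (Matrix.of fun b j => fderiv ℝ ((I b).valueAt h) v (Pi.single j 1)).row := hli.map' T hT
  rw [Matrix.linearIndependent_rows_iff_isUnit, Matrix.isUnit_iff_isUnit_det] at this
  exact this.ne_zero

/-- The universal 3-jet, whose entries are the jet coordinates. -/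
def univJet (n : ℕ) : Jet3 n (MvPolynomial (Coord n) ℝ) where
  x i := X (.x i)
  u := X .u
  u1 i := X (.u1 i)
  u2 i j := X (.u2 i j)
  u3 i j l := X (.u3 i j l)

/-- The polynomial `a ↦ P (A a)` on jets. -/
def translate (A : GL (Fin n) ℝ) (P : MvPolynomial (Coord n) ℝ) : MvPolynomial (Coord n) ℝ :=
  aeval ((univJet n).pull ((A⁻¹).val.map C) (A.val.map C)).coord P

theorem eval_translate (A : GL (Fin n) ℝ) (P : MvPolynomial (Coord n) ℝ) (a : Jet3 n ℝ) :
    eval a.coord (translate A P) = eval (a.act A).coord P := by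
  have h1 : (univJet n).map (eval a.coord) = a := by
    refine Jet3.ext_fields ?_ ?_ ?_ ?_ ?_ <;> simp [Jet3.map, univJet, Jet3.coord]
  have hC : ∀ B : Matrix (Fin n) (Fin n) ℝ, (B.map C).map (eval a.coord) = B := fun B => by
    ext; simp
  have h2 := Jet3.map_pull (eval a.coord) ((A⁻¹).val.map C) (A.val.map C) (univJet n)
  rw [h1, hC, hC] at h2
  rw [Jet3.act_eq_pull, ← h2, translate, ← coe_aeval_eq_eval, ← coe_aeval_eq_eval, RingHom.coe_coe,
    RingHom.coe_coe, ← AlgHom.comp_apply, comp_aeval]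
  congr 2
  exact funext fun c => (Jet3.coord_map _ _ c).symm

theorem along_translate (A : GL (Fin n) ℝ) (h : MvPolynomial (Fin n) ℝ)
    (P : MvPolynomial (Coord n) ℝ) :
    along (linSub A.val h) (translate A P) = linSub A.val (along h P) :=
  MvPolynomial.funext fun v => by
    rw [eval_along, eval_translate, act_jetAt_linSub, eval_linSub, eval_along]

/-- An invariant takes the same value, up to the denominators, along an orbit. -/
theorem JetFraction.IsInvariant.cross {k : ℕ} {I : JetFraction n} (hI : I.IsInvariant k)
    (A B : GL (Fin n) ℝ) {a : Jet3 n ℝ} (ha : a ∈ Euler3 n k) :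
    eval (a.act A).coord I.num * eval (a.act B).coord I.den =
      eval (a.act B).coord I.num * eval (a.act A).coord I.den := by
  have := hI.2 (A * B⁻¹) _ (Jet3.act_mem_Euler3 B ha)
  rwa [Jet3.act_mul, inv_mul_cancel_right] at this

theorem Jet3.act_one (a : Jet3 n ℝ) : a.act 1 = a := by
  refine Jet3.ext_fields ?_ rfl ?_ ?_ ?_ <;>
    simp [Jet3.act, Matrix.one_apply]

/-- The fraction `(P + t P∘A) / (Q + t Q∘A)`, which represents the same invariant as `P / Q`. -/
def JetFraction.mix (A : GL (Fin n) ℝ) (t : ℝ) (I : JetFraction n) : JetFraction n :=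
  ⟨I.num + C t * translate A I.num, I.den + C t * translate A I.den⟩

theorem JetFraction.IsInvariant.mix {k : ℕ} {I : JetFraction n} (hI : I.IsInvariant k)
    {A : GL (Fin n) ℝ} {t : ℝ} (hne : ∃ a ∈ Euler3 n k, eval a.coord (I.mix A t).den ≠ 0) :
    (I.mix A t).IsInvariant k := by
  refine ⟨hne, fun B a ha => ?_⟩
  simp only [JetFraction.mix, map_add, map_mul, eval_C, eval_translate, Jet3.act_mul]
  have h1 := hI.cross B 1 ha
  have h2 := hI.cross B A ha
  have h3 := hI.cross (A * B) 1 ha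
  have h4 := hI.cross (A * B) A ha
  rw [Jet3.act_one] at h1 h3
  linear_combination h1 + t * h2 + t * h3 + t ^ 2 * h4

/-- A pencil of polynomials contains the zero polynomial at most once. -/
theorem finite_pencil_zeros {σ : Type*} {p q : MvPolynomial σ ℝ} (hpq : p ≠ 0 ∨ q ≠ 0) :
    {t : ℝ | p + C t * q = 0}.Finite := by
  refine Set.Subsingleton.finite fun s (hs : p + C s * q = 0) t (ht : p + C t * q = 0) => ?_
  by_contra hst
  have hq : q = 0 := by
    have : C (s - t) * q = 0 := by rw [C_sub]; linear_combination hs - ht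
    exact (mul_eq_zero.1 this).resolve_left (C_ne_zero.2 (sub_ne_zero.2 hst))
  rw [hq, mul_zero, add_zero] at hs
  exact hpq.elim (· hs) (· hq)

/-- A system of invariants in general position along `h` can be rewritten so as to be in general
position along a form equivalent to `h` too. The denominators given along `h` may vanish identically
along the other form; a general member of the pencil `mix` avoids this. -/
theorem exists_common_system {k : ℕ} (hn : n ≠ 0) (hk : 2 ≤ k) {h : MvPolynomial (Fin n) ℝ}
    (hh : h.IsHomogeneous k) {A : GL (Fin n) ℝ} (hh' : (linSub A.val h).IsHomogeneous k)
    {I : Fin n → JetFraction n} (hI : IsInvariantSystem k I) (hg : InGeneralPositionAlong I h) :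
    ∃ I', IsInvariantSystem k I' ∧ InGeneralPositionAlong I' h ∧
      InGeneralPositionAlong I' (linSub A.val h) := by
  obtain ⟨hden, hjac⟩ := inGeneralPositionAlong_iff.1 hg
  have hex : ∀ i : Fin n, ∃ K : JetFraction n, K.IsInvariant k ∧ ((i : ℕ) + 1 = n → K = theta0 n) ∧
      along h K.den ≠ 0 ∧ along (linSub A.val h) K.den ≠ 0 ∧ K.value h = (I i).value h := by
    intro i
    by_cases hi : (i : ℕ) + 1 = n
    · have hone : ∀ g : MvPolynomial (Fin n) ℝ, along g (theta0 n).den ≠ 0 := by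
        simp [along, theta0]
      have := hI.1 i
      rw [hI.2 i hi] at this ⊢
      exact ⟨theta0 n, this, fun _ => rfl, hone _, hone _, rfl⟩
    · have hsub : ∀ p, linSub A.val p = 0 → p = 0 := fun p hp => linSub_injective A (by simpa using hp)
      obtain ⟨t, ht⟩ := ((finite_pencil_zeros (q := along h (translate A (I i).den))
        (Or.inl (hden i))).union (finite_pencil_zeros (p := along (linSub A.val h) (I i).den)
          (q := along (linSub A.val h) (translate A (I i).den))
          (Or.inr (by rw [along_translate]; exact fun h0 => hden i (hsub _ h0))))).exists_notMem
      have hmix : ∀ g : MvPolynomial (Fin n) ℝ, along g ((I i).mix A t).den =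
          along g (I i).den + C t * along g (translate A (I i).den) := by
        intro g; simp [along, JetFraction.mix, MvPolynomial.algebraMap_eq]
      simp only [Set.mem_union, Set.mem_ofPred_eq, not_or, ← hmix] at ht
      refine ⟨(I i).mix A t, (hI.1 i).mix ?_, fun h0 => absurd h0 hi, ht.1, ht.2, ?_⟩
      · by_contra! hcon
        refine ht.1 (eq_of_eval_eq hn fun v hv => ?_)
        rw [eval_along, hcon _ (jetAt_mem_Euler3 hk hh hv), map_zero]
      · rw [value_eq, value_eq, div_eq_div_iff (RatFn.algebraMap_ne_zero ht.1)
          (RatFn.algebraMap_ne_zero (hden i)), ← map_mul, ← map_mul]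
        congr 1
        refine eq_of_eval_eq hn fun v hv => ?_
        have := (hI.1 i).2 A _ (jetAt_mem_Euler3 hk hh hv)
        simp only [map_mul, eval_along, JetFraction.mix, map_add, eval_C, eval_translate]
        linear_combination t * this
  choose K hK1 hK2 hK3 hK4 hK5 using hex
  have hvals : (fun b => (K b).value h) = fun b => (I b).value h := funext hK5
  refine ⟨K, ⟨hK1, hK2⟩, inGeneralPositionAlong_iff.2 ⟨hK3, by rwa [hvals]⟩,
    inGeneralPositionAlong_iff.2 ⟨hK4, ?_⟩⟩
  have hvals' : (fun b => (K b).value (linSub A.val h)) = fun b => ratSub A ((I b).value h) := by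
    ext1 b
    rw [value_linSub hn hk (hK1 b) hh' (hK3 b) (hK4 b), hK5]
  have hdet : (jacobian fun b => (I b).value h).map (ratSub A) =
      (ratSub A).mapMatrix (jacobian fun b => (I b).value h) := rfl
  rw [hvals', jacobian_ratSub, Matrix.det_mul, hdet, ← AlgHom.map_det]
  refine mul_ne_zero ((map_ne_zero _).2 hjac) (left_ne_zero_of_mul_eq_one
    (b := (constMatrix (A⁻¹).val).det) ?_)
  rw [← Matrix.det_mul, constMatrix_mul_inv, Matrix.det_one]

end FormJet

end

theorem mainTheorem2 (n k : ℕ) (hn : 2 ≤ n) (hk : 3 ≤ k)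
    (h h' : MvPolynomial (Fin n) ℝ)
    (hreg : FormJet.IsRegularForm k h) (hreg' : FormJet.IsRegularForm k h') :
    (∀ I : Fin n → FormJet.JetFraction n, FormJet.IsInvariantSystem k I →
      FormJet.InGeneralPositionAlong I h → FormJet.InGeneralPositionAlong I h' →
      (FormJet.Equivalent h h' ↔ FormJet.piImage I h = FormJet.piImage I h')) ∧
    (FormJet.Equivalent h h' ↔
      ∃ I : Fin n → FormJet.JetFraction n, FormJet.IsInvariantSystem k I ∧
        FormJet.InGeneralPositionAlong I h ∧ FormJet.InGeneralPositionAlong I h' ∧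
        FormJet.piImage I h = FormJet.piImage I h') := by
  have hn0 : n ≠ 0 := by omega
  have hk2 : 2 ≤ k := by omega
  have hess : ∀ g v, (FormJet.jetAt g v).Regular →
      (Matrix.of (FormJet.jetPoly (n := n) g).u2).det ≠ 0 := by
    intro g v hv h0
    refine hv.2.1 ?_
    rw [FormJet.det_hess_jetOf, h0, map_zero]
  obtain ⟨hh, v, -, hv, I₀, hI₀, hden, hli⟩ := hreg
  obtain ⟨hh', v', -, hv', -⟩ := hreg'
  obtain ⟨hdet, hT⟩ := FormJet.det_frameOf_ne_zero hn0 hk2 hh hv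
  obtain ⟨hdet', hT'⟩ := FormJet.det_frameOf_ne_zero hn0 hk2 hh' hv'
  have part1 : ∀ I : Fin n → FormJet.JetFraction n, FormJet.IsInvariantSystem k I →
      FormJet.InGeneralPositionAlong I h → FormJet.InGeneralPositionAlong I h' →
      (FormJet.Equivalent h h' ↔ FormJet.piImage I h = FormJet.piImage I h') := by
    intro I hI hg hg'
    refine ⟨fun e => ?_, FormJet.equivalent_of_piImage_eq hn0 hI hdet hdet' (hess _ _ hv)
      (hess _ _ hv') hg⟩
    have d := (FormJet.inGeneralPositionAlong_iff.1 hg).1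
    have d' := (FormJet.inGeneralPositionAlong_iff.1 hg').1
    refine Set.Subset.antisymm ?_ ?_
    · obtain ⟨A, rfl⟩ := FormJet.equivalent_iff.1 e
      exact FormJet.piImage_subset_of_equivalent hn0 hk2 hI.1 hh' d d' hdet hT hT'
    · obtain ⟨A, rfl⟩ := FormJet.equivalent_iff.1 e.symm
      exact FormJet.piImage_subset_of_equivalent hn0 hk2 hI.1 hh d' d hdet' hT' hT
  refine ⟨part1, fun e => ?_, fun ⟨I, hI, hg, hg', hPi⟩ => (part1 I hI hg hg').2 hPi⟩
  have hg₀ : FormJet.InGeneralPositionAlong I₀ h := FormJet.inGeneralPositionAlong_iff.2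
    ⟨fun i h0 => hden i (by rw [← FormJet.eval_along, h0, map_zero]),
      FormJet.det_jacobian_ne_zero hden hli⟩
  obtain ⟨A, rfl⟩ := FormJet.equivalent_iff.1 e
  obtain ⟨I, hI, hg, hg'⟩ := FormJet.exists_common_system hn0 hk2 hh hh' hI₀ hg₀
  exact ⟨I, hI, hg, hg', (part1 I hI hg hg').1 e⟩
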